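/- For a finite group $G$, let $G^{\#}$ be its set of non-identity elements. A subset $S\subseteq G^{\#}$ is a total dominating set (for the generating graph of $G$) if for every $g\in G^{\#}$ there is $s\in S$ with $G=\langle g,s\rangle$. The group $G$ has uniform spread $1$ if it has a conjugacy class $C$ such that for every $g\in G^{\#}$ there is $s\in C$ with $G=\langle g,s\rangle$; in that case the uniform domination number $\gamma_u(G)$ is the minimal size of a total dominating set for $G$ whose elements are all conjugate in $G$. Theorem. For every integer $n\ge 5$ the alternating group $A_n$ has uniform spread $1$ (so that $\gamma_u(A_n)$ is defined), and \[ \gamma_u(A_n)\le 77\,\log_2 n . \] Moreover, if $n\ge 6$ is even, then \[ \lceil \log_2 n\rceil-1\;\le\;\gamma_u(A_n)\;\le\;2\lceil \log_2 n\rceil . \] -/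

import Mathlib

/-- Adjacency in the generating graph of `G` (whose vertices are the non-identity elements):
`x` and `y` generate `G`. -/
def GeneratingAdj {G : Type*} [Group G] (x y : G) : Prop :=
  Subgroup.closure {x, y} = (⊤ : Subgroup G)

/-- `S` is a total dominating set for the generating graph of `G`: it consists of non-identity
elements, and each non-identity element of `G` generates `G` together with some element of `S`. -/
def IsTotalDominatingSet {G : Type*} [Group G] (S : Set G) : Prop :=
  (∀ s ∈ S, s ≠ 1) ∧ ∀ g : G, g ≠ 1 → ∃ s ∈ S, GeneratingAdj g s

/-- `G` has uniform spread `k`: there is a fixed conjugacy class `C` such that any `k` non-identity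
elements `x i` have a common `g ∈ C` with `G = ⟨x i, g⟩` for all `i`. -/
def HasUniformSpread (G : Type*) [Group G] (k : ℕ) : Prop :=
  ∃ C : ConjClasses G, ∀ x : Fin k → G, (∀ i, x i ≠ 1) →
    ∃ g ∈ C.carrier, ∀ i, GeneratingAdj (x i) g

/-- The uniform domination number of a finite group `G` of uniform spread `1`: the minimal size of
a total dominating set for the generating graph of `G` consisting of elements that are conjugate
in `G`. -/
noncomputable def uniformDominationNumber (G : Type*) [Group G] : ℕ :=
  sInf {m : ℕ | ∃ S : Finset G, (∀ a ∈ S, ∀ b ∈ S, IsConj a b) ∧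
    IsTotalDominatingSet (S : Set G) ∧ S.card = m}

/-!
Total dominating sets are built from conjugates of a permutation with few cycles. Let `s` be an even
permutation of `n` points with one cycle of prime length `p`, where `p ∤ n` and `2 p ≤ n + 1`, and
with all other cycles of one length `q`: a single one if `n` is even, two of them if `n` is odd.
Suppose that joining each point to its image under `g` connects the cycles of `s`, that is, that
`⟨g, s⟩` is transitive.

* A nontrivial block meeting the `p`-cycle contains it, hence is a union of cycles of `s`; it is
  not the `p`-cycle alone since `p ∤ n`, and if it contains a further cycle, then it has more than
  half of the points. So `⟨g, s⟩` is primitive (`isPreprimitive_of_isCycle_mem`).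
* The power `s ^ q` is a `p`-cycle. By Jordan's criterion `⟨g, s⟩` is `(n - p + 1)`-transitive, so
  some conjugate of this `p`-cycle meets it in exactly one point. Their commutator is a `3`-cycle,
  so `⟨g, s⟩` contains the alternating group (`alternatingGroup_le_of_isCycle_mem`).

Thus a set of conjugates of `s` is a total dominating set as soon as every nontrivial even `g`
connects the cycles of one of them, which is a question about colourings of the points
(`IsCycleColouring.exists_isTotalDominatingSet`).

For even `n ≥ 8` Bertrand's postulate gives `p` between `n / 4` and `n / 2`, and `g` has to move one
of the `p`-sets that are the short cycles. Each set of points or its complement is the intersection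
or the union of two `p`-sets; applied to the sets given by the binary digits, this yields
`2 ⌈log₂ n⌉` sets of size `p` such that only the identity preserves all of them. For `n = 6` there
is no such prime, and five explicit `5`-cycles are used: the generated groups are still primitive,
and the `3`-cycle in them is found by evaluating words.

For odd `n` a nontrivial even `g` moves `a ↦ b` and either `b ↦ c` or `c ↦ d`, for distinct points
`a`, `b`, `c`, `d`. It connects the three cycles of `s` if `a`, `b`, `c` lie in distinct cycles and
`c`, `d` do, which happens for at least one in `24` of the quadruples. A union bound over all
quadruples shows that `17 (⌊log₂ n⁴⌋ + 1)` conjugates suffice.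

For the lower bound in even degree, an even permutation is not an `n`-cycle, so it preserves a
proper nonempty set of points. If `2 ^ (m + 1) < n`, then three points are not separated by the
sets belonging to `m` given elements, and a `3`-cycle on them generates a proper subgroup with each
of the elements (`IsTotalDominatingSet.card_le_two_pow`).
-/

/-! ### Generation by a permutation with a long prime cycle -/

section Generation

open Equiv Equiv.Perm MulAction Subgroup
open scoped Pointwise

variable {α : Type*} [Fintype α] [DecidableEq α]

/-- Two permutations whose supports meet in exactly one point have a `3`-cycle as their
commutator. -/
theorem Equiv.Perm.isThreeCycle_commutator {σ τ : Perm α} {a : α} (hσ : σ a ≠ a) (hτ : τ a ≠ a)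
    (h : ∀ x, σ x ≠ x → τ x ≠ x → x = a) : (σ * τ * σ⁻¹ * τ⁻¹).IsThreeCycle := by
  have key : σ * τ * σ⁻¹ * τ⁻¹ = swap a (τ a) * swap a (σ a) := by
    have hor : ∀ x, x ≠ a → σ x = x ∨ τ x = x := fun x hx => by
      by_contra! hc
      exact hx (h x hc.1 hc.2)
    have hσn : ∀ x, x ≠ a → σ x ≠ a → σ x ≠ x → τ (σ x) = σ x := fun x _ h2 h3 => by
      rcases hor (σ x) h2 with h4 | h4
      · exact absurd (σ.injective h4) h3
      · exact h4
    have hu : τ (σ a) = σ a := (hor _ hσ).resolve_left fun h4 => hσ (σ.injective h4)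
    have hv : σ (τ a) = τ a := (hor _ hτ).resolve_right fun h4 => hτ (τ.injective h4)
    have huv : σ a ≠ τ a := fun h4 => hτ (τ.injective (h4 ▸ hu))
    rw [mul_inv_eq_iff_eq_mul, mul_inv_eq_iff_eq_mul]
    -- both sides are evaluated at `σ x`, so that only forward images occur
    ext x
    simp only [Perm.mul_apply]
    by_cases hxa : x = a
    · subst hxa
      rw [hu, swap_apply_right, swap_apply_left, hv]
    by_cases hxσ : σ x = x
    · rw [hxσ]
      by_cases hxt : τ x = x
      · rw [hxt, hxσ, swap_apply_of_ne_of_ne hxa, swap_apply_of_ne_of_ne hxa]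
        · rintro rfl; exact hxa (τ.injective hxt)
        · rintro rfl; exact hxa (σ.injective hxσ)
      · by_cases hta : τ x = a
        · rw [hta, swap_apply_left, swap_apply_of_ne_of_ne hσ huv]
        · have h5 : σ (τ x) = τ x := (hor _ hta).resolve_right fun h4 => hxt (τ.injective h4)
          rw [h5, swap_apply_of_ne_of_ne hta, swap_apply_of_ne_of_ne hta]
          · exact fun h6 => hxa (τ.injective h6)
          · intro h6
            apply hxt
            rw [← hu] at h6
            have := τ.injective h6
            rw [this] at h5
            rw [this]; exact hu
    · have hxt : τ x = x := (hor x hxa).resolve_left hxσ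
      rw [hxt]
      by_cases hta : σ x = a
      · have : τ a ≠ σ a := huv.symm
        rw [hta, swap_apply_of_ne_of_ne hτ this, swap_apply_right]
      · have h5 := hσn x hxa hta hxσ
        rw [h5, swap_apply_of_ne_of_ne hta, swap_apply_of_ne_of_ne hta]
        · intro h6
          apply hxσ
          have h7 : σ x = τ x := by rw [h6] at h5; exact absurd (τ.injective h5) hτ
          rw [h7, hxt]
        · exact fun h6 => hxa (σ.injective h6)
  rw [key]
  refine isThreeCycle_swap_mul_swap_same hτ.symm hσ.symm ?_
  intro h4
  have hu : τ (σ a) = σ a := by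
    by_contra h5
    exact hσ (h _ (fun h6 => hσ (σ.injective h6)) h5)
  rw [← h4] at hu
  exact hτ (τ.injective hu)

/-- A transitive group containing a cycle `σ` of prime length `p` is primitive if `p` does not
divide the degree and every set that is invariant under some element `s` of the group and strictly
contains the support of `σ` has more than half of the points. -/
theorem isPreprimitive_of_isCycle_mem {G : Subgroup (Perm α)} (hG : IsPretransitive G α)
    {σ s : Perm α} (hσG : σ ∈ G) (hsG : s ∈ G) (hσ : σ.IsCycle) {p : ℕ} (hp : p.Prime)
    (hσp : σ.support.card = p) (hpn : ¬ p ∣ Fintype.card α)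
    (hsσ : ∀ x, σ x ≠ x → σ (s x) ≠ s x)
    (hbig : ∀ B : Set α, (σ.support : Set α) ⊂ B → (∀ x ∈ B, s x ∈ B) →
      Fintype.card α < B.ncard * 2) :
    IsPreprimitive G α := by
  obtain ⟨a, ha, hcyc⟩ := id hσ
  refine IsPreprimitive.of_isTrivialBlock_base a fun {B} haB hB => ?_
  by_cases hsub : B.Subsingleton
  · exact Or.inl hsub
  right
  have hinv : ∀ g : G, (∃ x ∈ B, g • x ∈ B) → g • B = B := fun g ⟨x, hx, hgx⟩ =>
    (isBlock_iff_smul_eq_of_mem.1 hB) hx hgx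
  obtain ⟨b, hb, hba⟩ : ∃ b ∈ B, b ≠ a := by
    by_contra! hc
    exact hsub fun x hx y hy => (hc x hx).trans (hc y hy).symm
  let σ' : G := ⟨σ, hσG⟩
  have hσB : σ' • B = B := by
    by_cases hbσ : σ b = b
    · exact hinv σ' ⟨b, hb, by change σ b ∈ B; rwa [hbσ]⟩
    obtain ⟨k, hk⟩ := hcyc hbσ
    have hk' : σ' ^ k ∈ stabilizer G B :=
      hinv (σ' ^ k) ⟨a, haB, by
        have : (σ' ^ k) • a = (σ ^ k) a := rfl
        rw [this, hk]; exact hb⟩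
    -- `⟨σ⟩` has prime order, so its element `σ ^ k ≠ 1` generates it
    have hne : (⟨σ' ^ k, zpow_mem (mem_zpowers σ') k⟩ : zpowers σ') ≠ 1 := by
      intro h1
      have h2 : σ' ^ k = 1 := congrArg Subtype.val h1
      have h3 : σ ^ k = 1 := by simpa [σ'] using congrArg Subtype.val h2
      rw [h3] at hk
      exact hba hk.symm
    have hcard : Nat.card (zpowers σ') = p := by
      rw [Nat.card_zpowers, ← hσp, ← hσ.orderOf]
      exact Subgroup.orderOf_mk σ hσG
    have : Fact p.Prime := ⟨hp⟩
    obtain ⟨j, hj⟩ := mem_zpowers_of_prime_card hcard hne (g' := ⟨σ', mem_zpowers σ'⟩)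
    have hj' : (σ' ^ k) ^ j = σ' := congrArg Subtype.val hj
    have := zpow_mem hk' j
    rwa [hj'] at this
  have hσpow : ∀ k : ℤ, (σ' ^ k) • B = B := fun k =>
    zpow_mem (show σ' ∈ stabilizer G B from hσB) k
  have hsupp : (σ.support : Set α) ⊆ B := by
    intro x hx
    obtain ⟨k, hk⟩ := hcyc (by simpa using hx)
    rw [← hk, ← hσpow k]
    exact ⟨a, haB, rfl⟩
  let s' : G := ⟨s, hsG⟩
  have hsB : s' • B = B := hinv s' ⟨a, haB, hsupp (by simpa [s'] using! hsσ a ha)⟩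
  rcases hsupp.eq_or_ssubset with heq | hss
  · exfalso
    apply hpn
    have := hB.ncard_dvd_card ⟨a, haB⟩
    rwa [← heq, Set.ncard_coe_finset, hσp, Nat.card_eq_fintype_card] at this
  · apply hB.eq_univ_of_card_lt
    rw [Nat.card_eq_fintype_card]
    refine hbig B hss fun x hx => ?_
    rw [← hsB]
    exact ⟨x, hx, rfl⟩

/-- A primitive group of degree `n` containing a cycle of prime length `p ≤ (n + 1) / 2` contains
the alternating group. By Jordan's criterion the group is so highly transitive that some conjugate
of the cycle meets it in a single point, and the commutator of the two is a `3`-cycle. -/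
theorem alternatingGroup_le_of_isCycle_mem {G : Subgroup (Perm α)} (hG : IsPreprimitive G α)
    {σ : Perm α} (hσG : σ ∈ G) (hσ : σ.IsCycle) {p : ℕ} (hp : p.Prime)
    (hσp : σ.support.card = p) (hpn : 2 * p ≤ Fintype.card α + 1) : alternatingGroup α ≤ G := by
  classical
  have hp2 := hp.two_le
  obtain ⟨k, hk⟩ : ∃ k, Fintype.card α = p + (k + 1) :=
    ⟨Fintype.card α - p - 1, by omega⟩
  have hcompl : σ.supportᶜ.card = k + 1 := by rw [Finset.card_compl, hσp]; omega
  have hM : IsMultiplyPreprimitive G α (k + 2) := by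
    apply hG.isMultiplyPreprimitive (s := (σ.supportᶜ : Set α))
    · rw [← Finset.coe_compl, Set.ncard_coe_finset, hcompl]
    · rw [Nat.card_eq_fintype_card]; omega
    · have := isPretransitive_of_isCycle_mem hσ hσG
      apply IsPreprimitive.of_prime_card
      convert! hp
      rw [Nat.card_eq_fintype_card, Fintype.card_subtype, ← hσp]
      congr 1
      ext x
      simp [SubMulAction.mem_ofFixingSubgroup_iff]
  obtain ⟨a, ha, -⟩ := id hσ
  have haA : a ∈ σ.support := mem_support.2 ha
  -- a permutation `π` with `π A ∩ A = {a}`, where `A` is the support of `σ`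
  obtain ⟨F, hFsub, hF⟩ := Finset.exists_subset_card_eq (s := σ.supportᶜ) (n := p - 1)
    (by rw [hcompl]; omega)
  have haF : a ∉ F := fun h => by simpa [ha] using hFsub h
  obtain ⟨π, hπ⟩ : ∃ π : Perm α, ∀ x ∈ σ.support, π x ∈ insert a F := by
    have hc : σ.support.card = (insert a F).card := by
      rw [Finset.card_insert_of_notMem haF, hF, hσp]; omega
    let e := Finset.equivOfCardEq hc
    obtain ⟨π, hπ⟩ := Equiv.Perm.exists_extending_pair (fun x : σ.support => (x : α))
      (fun x => ((e x : _) : α)) Subtype.val_injective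
      (Subtype.val_injective.comp e.injective)
    refine ⟨π, fun x hx => ?_⟩
    rw [hπ ⟨x, hx⟩]
    exact (e ⟨x, hx⟩).2
  have hπi : ∀ y, π (π⁻¹ y) = y := π.apply_symm_apply
  have hπi' : ∀ y, π⁻¹ (π y) = y := π.symm_apply_apply
  have hπA : ∀ y ∈ σ.support, y ≠ a → π⁻¹ y ∉ σ.support := fun y hy hya hc => by
    have := hπ _ hc
    rw [hπi] at this
    rcases Finset.mem_insert.1 this with h | h
    · exact hya h
    · exact Finset.mem_compl.1 (hFsub h) hy
  have haπ : π⁻¹ a ∈ σ.support := by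
    have hsurj : (σ.support.image π) = insert a F := by
      apply Finset.eq_of_subset_of_card_le
      · intro y hy
        obtain ⟨x, hx, rfl⟩ := Finset.mem_image.1 hy
        exact hπ x hx
      · rw [Finset.card_image_of_injective _ π.injective, Finset.card_insert_of_notMem haF, hF, hσp]
        omega
    obtain ⟨x, hx, hxa⟩ := Finset.mem_image.1 (hsurj ▸ Finset.mem_insert_self a F)
    rwa [← hxa, hπi']
  set a₀ := π⁻¹ a with ha₀
  -- some `h ∈ G` agrees with `π` on the complement of `A` and at `π⁻¹ a`
  obtain ⟨h, hhG, hh⟩ : ∃ h ∈ G, ∀ x ∈ insert a₀ σ.supportᶜ, h x = π x := by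
    have hc : (insert a₀ σ.supportᶜ).card = k + 2 := by
      rw [Finset.card_insert_of_notMem (by simpa using haπ), hcompl]
    let e := (Finset.equivFinOfCardEq hc).symm
    let x : Fin (k + 2) ↪ α := e.toEmbedding.trans (Function.Embedding.subtype _)
    obtain ⟨h, hh⟩ := isMultiplyPretransitive_iff.1 hM.isMultiplyPretransitive x
      (x.trans π.toEmbedding)
    refine ⟨h, h.2, fun y hy => ?_⟩
    have := DFunLike.congr_fun hh (e.symm ⟨y, hy⟩)
    simpa [x] using! this
  have hha : h a₀ = a := by rw [hh _ (Finset.mem_insert_self _ _), ha₀, hπi]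
  refine alternatingGroup_le_of_isPreprimitive_of_isThreeCycle_mem hG
    (isThreeCycle_commutator (σ := σ) (τ := h * σ * h⁻¹) (a := a) ha ?_ ?_) ?_
  · have : h⁻¹ a = a₀ := by rw [Perm.inv_eq_iff_eq, hha]
    simp only [Perm.mul_apply, this]
    rw [← hha]
    exact fun hc => (mem_support.1 haπ) (h.injective hc)
  · intro y hy hτy
    by_contra hya
    have h1 := hπA y (mem_support.2 hy) hya
    have h2 : h (π⁻¹ y) = y := by
      rw [hh _ (Finset.mem_insert_of_mem (Finset.mem_compl.2 h1)), hπi]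
    have h3 : h⁻¹ y = π⁻¹ y := by rw [Perm.inv_eq_iff_eq, h2]
    apply hτy
    simp only [Perm.mul_apply, h3]
    rw [notMem_support.1 h1, h2]
  · exact G.mul_mem (G.mul_mem (G.mul_mem hσG (G.mul_mem (G.mul_mem hhG hσG) (G.inv_mem hhG)))
      (G.inv_mem hσG)) (G.inv_mem (G.mul_mem (G.mul_mem hhG hσG) (G.inv_mem hhG)))

end Generation

/-! ### Colourings by cycles -/

section Colouring

open Equiv Equiv.Perm MulAction Subgroup
open scoped Pointwise

variable {α : Type*} {ι : Type*}

/-- The colouring `f` of the points has the cycles of the permutation `s` (fixed points included)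
as its colour classes. -/
def IsCycleColouring (f : α → ι) (s : Perm α) : Prop :=
  ∀ x y, s.SameCycle x y ↔ f x = f y

/-- Joining every point to its image under `g` connects all colour classes of `f`: the only
equivalence relation that relates points of equal colour, and each `x` to `g x`, is the
full one. -/
def ConnectsColours (f : α → ι) (g : Perm α) : Prop :=
  ∀ r : Setoid α, (∀ x y, f x = f y → r x y) → (∀ x, r x (g x)) → ∀ x y, r x y

theorem IsCycleColouring.conj {f : α → ι} {s : Perm α} (hs : IsCycleColouring f s) (h : Perm α) :
    IsCycleColouring (fun x => f (h⁻¹ x)) (h * s * h⁻¹) := fun x y => by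
  rw [sameCycle_conj, hs]

theorem IsCycleColouring.apply_eq {f : α → ι} {s : Perm α} (hs : IsCycleColouring f s) (x : α) :
    f (s x) = f x :=
  (hs _ _).1 (sameCycle_apply_left.2 (SameCycle.refl _ _))

theorem IsCycleColouring.isPretransitive_closure [Nonempty α] {f : α → ι} {g s : Perm α}
    (hs : IsCycleColouring f s) (hg : ConnectsColours f g) :
    IsPretransitive (closure {g, s}) α := by
  rw [isPretransitive_iff]
  intro x y
  have key := hg (orbitRel (closure {g, s}) α) ?_ ?_ y x
  · exact mem_orbit_iff.1 key
  · intro x y hxy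
    obtain ⟨k, hk⟩ := (hs y x).2 hxy.symm
    exact ⟨⟨s ^ k, zpow_mem (subset_closure (by simp)) k⟩, hk⟩
  · intro x
    refine (orbitRel (closure {g, s}) α).symm ?_
    exact ⟨⟨g, subset_closure (by simp)⟩, rfl⟩

variable [Fintype α] [DecidableEq α] [DecidableEq ι]

theorem IsCycleColouring.pow_card_apply {f : α → ι} {s : Perm α} (hs : IsCycleColouring f s)
    (x : α) : (s ^ (Finset.univ.filter fun y => f y = f x).card) x = x := by
  by_cases hx : s x = x
  · exact pow_apply_eq_self_of_apply_eq_self hx _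
  · have h1 : (Finset.univ.filter fun y => f y = f x) = (s.cycleOf x).support := by
      ext y
      rw [mem_support_cycleOf_iff' hx]
      simp only [Finset.mem_filter, Finset.mem_univ, true_and]
      rw [hs, eq_comm]
    rw [h1, ← (isCycle_cycleOf s hx).orderOf, ← cycleOf_pow_apply_self, pow_orderOf_eq_one,
      Perm.one_apply]

variable {κ : Type*} [DecidableEq κ] {f : α → Option κ} {g s : Perm α} {p q : ℕ}

/-- If a permutation has one cycle of prime length `p` and all other cycles of length `q`, with
`p ∤ q`, then its `q`-th power is a `p`-cycle. -/
theorem IsCycleColouring.isCycle_pow (hs : IsCycleColouring f s) (hp : p.Prime)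
    (hfp : (Finset.univ.filter fun x => f x = none).card = p)
    (hfq : ∀ k, (Finset.univ.filter fun x => f x = some k).card = q) (hpq : ¬ p ∣ q) :
    (s ^ q).IsCycle ∧ (s ^ q).support = Finset.univ.filter fun x => f x = none := by
  have h0 : ∀ x, f x = none → (s ^ p) x = x := fun x hx => by
    have := hs.pow_card_apply x
    rwa [hx, hfp] at this
  have h1 : ∀ x, f x ≠ none → (s ^ q) x = x := fun x hx => by
    obtain ⟨k, hk⟩ := Option.ne_none_iff_exists'.1 hx
    have := hs.pow_card_apply x
    rwa [hk, hfq] at this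
  have hcop : IsCoprime (p : ℤ) q := Nat.isCoprime_iff_coprime.2 ((hp.coprime_iff_not_dvd).2 hpq)
  have hzp : ∀ x, f x = none → ∀ k : ℤ, (s ^ (p * k)) x = x := fun x hx k => by
    rw [zpow_mul, zpow_natCast]
    exact zpow_apply_eq_self_of_apply_eq_self (h0 x hx) k
  obtain ⟨u, v, huv⟩ := hcop
  -- on the `p`-cycle, `s = (s ^ q) ^ v`
  have hv : ∀ x, f x = none → ∀ k : ℤ, ((s ^ q) ^ (v * k)) x = (s ^ k) x := fun x hx k => by
    have : s ^ k = (s ^ q) ^ (v * k) * s ^ (p * (u * k)) := by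
      rw [← zpow_natCast, ← zpow_mul, ← zpow_add]
      congr 1
      linear_combination -k * huv
    rw [this, Perm.mul_apply, hzp x hx]
  have h2 : ∀ x, f x = none → (s ^ q) x ≠ x := fun x hx hc => by
    have hsx : ∀ k : ℤ, (s ^ k) x = x := fun k => by
      rw [← hv x hx k]
      exact zpow_apply_eq_self_of_apply_eq_self hc _
    have : (Finset.univ.filter fun y => f y = none) ⊆ {x} := fun y hy => by
      obtain ⟨k, hk⟩ := (hs x y).2 (hx.trans (Finset.mem_filter.1 hy).2.symm)
      rw [hsx] at hk
      simp [hk]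
    have := Finset.card_le_card this
    rw [hfp, Finset.card_singleton] at this
    exact absurd hp.two_le (by omega)
  have hsupp : (s ^ q).support = Finset.univ.filter fun x => f x = none := by
    ext x
    simp only [mem_support, Finset.mem_filter, Finset.mem_univ, true_and]
    exact ⟨fun h => by_contra fun hc => h (h1 x hc), h2 x⟩
  refine ⟨?_, hsupp⟩
  obtain ⟨x, hx⟩ : (Finset.univ.filter fun x => f x = none).Nonempty :=
    Finset.card_pos.1 (hfp ▸ hp.pos)
  rw [Finset.mem_filter] at hx
  refine ⟨x, h2 x hx.2, fun y hy => ?_⟩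
  have hy' : f y = none := by_contra fun hc => hy (h1 y hc)
  obtain ⟨k, hk⟩ := (hs x y).2 (hx.2.trans hy'.symm)
  exact ⟨v * k, by rw [hv x hx.2, hk]⟩

theorem IsCycleColouring.isPreprimitive_closure [Nonempty α] (hs : IsCycleColouring f s)
    (hg : ConnectsColours f g) (hp : p.Prime)
    (hfp : (Finset.univ.filter fun x => f x = none).card = p)
    (hfq : ∀ k, (Finset.univ.filter fun x => f x = some k).card = q) (hpq : ¬ p ∣ q)
    (hpn : ¬ p ∣ Fintype.card α) (hn : Fintype.card α < (p + q) * 2) :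
    IsPreprimitive (closure {g, s}) α := by
  obtain ⟨hc, hsupp⟩ := hs.isCycle_pow hp hfp hfq hpq
  have hsG : s ∈ closure {g, s} := subset_closure (by simp)
  refine isPreprimitive_of_isCycle_mem (hs.isPretransitive_closure hg) (pow_mem hsG q) hsG hc hp
    (by rw [hsupp, hfp]) hpn ?_ ?_
  · intro x hx
    rw [← mem_support, hsupp] at hx ⊢
    simpa [hs.apply_eq] using hx
  · intro B hAB hB
    obtain ⟨x, hxB, hxA⟩ := Set.exists_of_ssubset hAB
    rw [hsupp] at hxA
    obtain ⟨k, hk⟩ := Option.ne_none_iff_exists'.1 (by simpa using hxA : f x ≠ none)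
    have hpow : ∀ m : ℕ, (s ^ m) x ∈ B := fun m => by
      induction m with
      | zero => exact hxB
      | succ m ih => rw [pow_succ', Perm.mul_apply]; exact hB _ ih
    -- `B` contains the whole cycle of `x` besides the `p`-cycle
    have hsub : (((Finset.univ.filter fun x => f x = none) ∪
        (Finset.univ.filter fun x => f x = some k) : Finset α) : Set α) ⊆ B := by
      rw [Finset.coe_union]
      refine Set.union_subset (hsupp ▸ hAB.subset) fun y hy => ?_
      have hy' : f y = some k := by simpa using hy
      obtain ⟨m, hm⟩ := ((hs x y).2 (hk.trans hy'.symm)).exists_nat_pow_eq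
      rw [← hm]
      exact hpow m
    have := Set.ncard_le_ncard hsub
    rw [Set.ncard_coe_finset, Finset.card_union_of_disjoint, hfp, hfq] at this
    · omega
    · rw [Finset.disjoint_filter]
      intro y _ h1 h2
      rw [h1] at h2
      exact absurd h2 (by simp)

/-- The generation criterion: if `g` connects the cycles of `s`, then `g` and `s` generate at least
the alternating group. -/
theorem IsCycleColouring.alternatingGroup_le_closure [Nonempty α] (hs : IsCycleColouring f s)
    (hg : ConnectsColours f g) (hp : p.Prime)
    (hfp : (Finset.univ.filter fun x => f x = none).card = p)
    (hfq : ∀ k, (Finset.univ.filter fun x => f x = some k).card = q) (hpq : ¬ p ∣ q)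
    (hpn : ¬ p ∣ Fintype.card α) (hn : Fintype.card α < (p + q) * 2)
    (hpn' : 2 * p ≤ Fintype.card α + 1) :
    alternatingGroup α ≤ closure {g, s} := by
  obtain ⟨hc, hsupp⟩ := hs.isCycle_pow hp hfp hfq hpq
  exact alternatingGroup_le_of_isCycle_mem
    (hs.isPreprimitive_closure hg hp hfp hfq hpq hpn hn)
    (pow_mem (subset_closure (by simp)) q) hc hp (by rw [hsupp, hfp]) hpn'

end Colouring

/-! ### Permutations with prescribed cycle lengths -/

section Construction

open Equiv Equiv.Perm MulAction Subgroup
open scoped Pointwise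

theorem sameCycle_finRotate {n : ℕ} (x y : Fin n) : (finRotate n).SameCycle x y := by
  match n, x, y with
  | 1, x, y => rw [Subsingleton.elim x y]
  | n + 2, x, y =>
    exact isCycle_finRotate.sameCycle
      (by rw [← mem_support, support_finRotate]; exact Finset.mem_univ _)
      (by rw [← mem_support, support_finRotate]; exact Finset.mem_univ _)

theorem Equiv.Perm.SameCycle.map_of_semiconj {α β : Type*} [Finite β] {t : Perm β} {s : Perm α} {φ : β → α}
    (hφ : ∀ x, φ (t x) = s (φ x)) {x y : β} (h : t.SameCycle x y) :
    s.SameCycle (φ x) (φ y) := by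
  obtain ⟨i, rfl⟩ := h.exists_nat_pow_eq
  refine ⟨i, ?_⟩
  rw [zpow_natCast]
  clear h
  induction i with
  | zero => rfl
  | succ i ih => rw [pow_succ', pow_succ', Perm.mul_apply, Perm.mul_apply, hφ, ih]

/-- A permutation with one cycle of length `p` and cycles of length `q` indexed by `κ`. -/
theorem exists_isCycleColouring {α : Type*} [Fintype α] [DecidableEq α] (κ : Type*) [Fintype κ]
    [DecidableEq κ] {p q : ℕ} (h : Fintype.card α = p + Fintype.card κ * q) :
    ∃ (f : α → Option κ) (s : Perm α), IsCycleColouring f s ∧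
      (Finset.univ.filter fun x => f x = none).card = p ∧
      (∀ k, (Finset.univ.filter fun x => f x = some k).card = q) ∧
      sign s = (-1) ^ (p - 1) * ((-1) ^ (q - 1)) ^ Fintype.card κ := by
  let e : α ≃ Fin p ⊕ (κ × Fin q) := Fintype.equivOfCardEq (by simp [h])
  let f₀ : Fin p ⊕ (κ × Fin q) → Option κ := Sum.elim (fun _ => none) (fun x => some x.1)
  let s₀ : Perm (Fin p ⊕ (κ × Fin q)) :=
    Perm.sumCongr (finRotate p) (prodCongrRight fun _ => finRotate q)
  have hs₀ : IsCycleColouring f₀ s₀ := by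
    intro x y
    constructor
    · rintro ⟨i, rfl⟩
      have h1 : ∀ z, f₀ (s₀ z) = f₀ z := by rintro (z | ⟨k, z⟩) <;> rfl
      have h2 : ∀ (i : ℕ) z, f₀ ((s₀ ^ i) z) = f₀ z := fun i z => by
        induction i with
        | zero => rfl
        | succ i ih => rw [pow_succ', Perm.mul_apply, h1, ih]
      cases i with
      | ofNat i => exact (h2 i x).symm
      | negSucc i =>
        rw [zpow_negSucc, ← h2 (i + 1) ((s₀ ^ (i + 1))⁻¹ x)]
        exact congrArg f₀ ((s₀ ^ (i + 1)).apply_symm_apply x).symm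
    · rcases x with x | ⟨k, x⟩ <;> rcases y with y | ⟨l, y⟩ <;> intro hxy
      · exact Equiv.Perm.SameCycle.map_of_semiconj (φ := Sum.inl) (fun _ => rfl) (sameCycle_finRotate x y)
      · simp [f₀] at hxy
      · simp [f₀] at hxy
      · obtain rfl : k = l := by simpa [f₀] using hxy
        exact Equiv.Perm.SameCycle.map_of_semiconj (φ := fun z => Sum.inr (k, z)) (fun _ => rfl)
          (sameCycle_finRotate x y)
  refine ⟨f₀ ∘ e, e.symm.permCongr s₀, fun x y => ?_, ?_, fun k => ?_, ?_⟩
  · rw [Function.comp_apply, Function.comp_apply, ← hs₀]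
    constructor <;> intro hxy
    · exact Equiv.Perm.SameCycle.map_of_semiconj (φ := e) (fun z => by simp [permCongr_apply]) hxy
    · simpa using Equiv.Perm.SameCycle.map_of_semiconj (φ := e.symm) (s := e.symm.permCongr s₀)
        (fun z => by simp [permCongr_apply]) hxy
  · rw [← Fintype.card_subtype]
    have e1 : {x // (f₀ ∘ e) x = none} ≃ Fin p :=
      (e.subtypeEquiv (q := fun x => f₀ x = none) (fun _ => Iff.rfl)).trans
        { toFun := fun x => match x with | ⟨Sum.inl i, _⟩ => i
          invFun := fun i => ⟨Sum.inl i, rfl⟩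
          left_inv := by rintro ⟨i | ⟨k, i⟩, hi⟩ <;> first | rfl | simp [f₀] at hi
          right_inv := fun _ => rfl }
    rw [Fintype.card_congr e1, Fintype.card_fin]
  · rw [← Fintype.card_subtype]
    have e1 : {x // (f₀ ∘ e) x = some k} ≃ Fin q :=
      (e.subtypeEquiv (q := fun x => f₀ x = some k) (fun _ => Iff.rfl)).trans
        { toFun := fun x => match x with | ⟨Sum.inr i, _⟩ => i.2
          invFun := fun i => ⟨Sum.inr (k, i), rfl⟩
          left_inv := by
            rintro ⟨i | ⟨l, i⟩, hi⟩
            · simp [f₀] at hi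
            · obtain rfl : l = k := by simpa [f₀] using hi
              rfl
          right_inv := fun _ => rfl }
    rw [Fintype.card_congr e1, Fintype.card_fin]
  · rw [sign_permCongr, sign_sumCongr, sign_prodCongrRight, sign_finRotate, sign_finRotate,
      Finset.prod_const, Finset.card_univ]

end Construction

/-! ### Total dominating sets of conjugate elements, and the lower bound in even degree -/

section Domination

open Equiv Equiv.Perm MulAction Subgroup
open scoped Pointwise

variable {α : Type*} [Fintype α] [DecidableEq α]

theorem generatingAdj_alternatingGroup_iff (x y : alternatingGroup α) :
    GeneratingAdj x y ↔ alternatingGroup α ≤ closure {(x : Perm α), (y : Perm α)} := by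
  have h : (closure {x, y}).map (alternatingGroup α).subtype = closure {(x : Perm α), ↑y} := by
    rw [MonoidHom.map_closure, Set.image_pair]
    rfl
  rw [← h, GeneratingAdj]
  constructor
  · intro h1
    rw [h1, ← MonoidHom.range_eq_map, range_subtype]
  · intro h1
    rw [eq_top_iff]
    intro z _
    obtain ⟨w, hw, hwz⟩ := h1 z.2
    rwa [← Subtype.ext (a1 := w) (a2 := z) hwz]

/-- A permutation may be replaced by an even one that induces the same colouring, as long as two
points have the same colour. -/
theorem exists_mem_alternatingGroup_comp_eq {ι : Type*} (f : α → ι) {a b : α} (hab : a ≠ b)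
    (hf : f a = f b) (k : Perm α) :
    ∃ k' ∈ alternatingGroup α, ∀ x, f (k' x) = f (k x) := by
  rcases Int.units_eq_one_or (sign k) with h | h
  · exact ⟨k, h, fun _ => rfl⟩
  · refine ⟨swap a b * k, ?_, fun x => ?_⟩
    · rw [mem_alternatingGroup, Perm.sign_mul, sign_swap hab, h]
      rfl
    · rw [Perm.mul_apply]
      by_cases h1 : k x = a
      · rw [h1, swap_apply_left, hf]
      by_cases h2 : k x = b
      · rw [h2, swap_apply_right, hf]
      rw [swap_apply_of_ne_of_ne h1 h2]

/-- If every `g ≠ 1` generates the alternating group together with some conjugate of `s` from a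
given family, then these conjugates form a total dominating set. -/
theorem exists_isTotalDominatingSet_of_conj {s : alternatingGroup α} (hs : s ≠ 1) {J : Type*}
    [Fintype J] (h : J → alternatingGroup α)
    (hgen : ∀ g : alternatingGroup α, g ≠ 1 → ∃ j,
      alternatingGroup α ≤ closure {(g : Perm α), (h j : Perm α) * s * (h j : Perm α)⁻¹}) :
    ∃ S : Finset (alternatingGroup α), (∀ a ∈ S, ∀ b ∈ S, IsConj a b) ∧
      IsTotalDominatingSet (S : Set (alternatingGroup α)) ∧ S.card ≤ Fintype.card J := by
  classical
  have hconj : ∀ j, IsConj s (h j * s * (h j)⁻¹) := fun j => isConj_iff.2 ⟨h j, rfl⟩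
  refine ⟨Finset.univ.image fun j => h j * s * (h j)⁻¹, ?_, ⟨?_, fun g hg => ?_⟩,
    Finset.card_image_le⟩
  · simp only [Finset.mem_image, Finset.mem_univ, true_and]
    rintro _ ⟨i, rfl⟩ _ ⟨j, rfl⟩
    exact (hconj i).symm.trans (hconj j)
  · intro x hx hc
    rw [Finset.mem_coe, Finset.mem_image] at hx
    obtain ⟨j, -, rfl⟩ := hx
    apply hs
    rw [← isConj_one_right, ← hc]
    exact (hconj j).symm
  · obtain ⟨j, hj⟩ := hgen g hg
    exact ⟨h j * s * (h j)⁻¹, by simp, (generatingAdj_alternatingGroup_iff _ _).2 hj⟩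

/-- If every nontrivial even permutation connects one of the translates `f ∘ k j` of the cycle
colouring `f` of `s`, then some conjugates of `s` in the alternating group, at most one for each
`j`, form a total dominating set. -/
theorem IsCycleColouring.exists_isTotalDominatingSet [Nonempty α] {κ : Type*} [DecidableEq κ]
    {f : α → Option κ} {s : Perm α} {p q : ℕ} (hs : IsCycleColouring f s)
    (hsign : s ∈ alternatingGroup α) (hp : p.Prime)
    (hfp : (Finset.univ.filter fun x => f x = none).card = p)
    (hfq : ∀ k, (Finset.univ.filter fun x => f x = some k).card = q) (hpq : ¬ p ∣ q)
    (hpn : ¬ p ∣ Fintype.card α) (hn : Fintype.card α < (p + q) * 2)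
    (hpn' : 2 * p ≤ Fintype.card α + 1)
    {J : Type*} [Fintype J] (k : J → Perm α)
    (hk : ∀ g ∈ alternatingGroup α, g ≠ 1 → ∃ j, ConnectsColours (fun x => f (k j x)) g) :
    ∃ S : Finset (alternatingGroup α), (∀ a ∈ S, ∀ b ∈ S, IsConj a b) ∧
      IsTotalDominatingSet (S : Set (alternatingGroup α)) ∧ S.card ≤ Fintype.card J := by
  classical
  obtain ⟨a, b, hab, hfab⟩ : ∃ a b, a ≠ b ∧ f a = f b := by
    obtain ⟨a, ha, b, hb, hab⟩ := Finset.one_lt_card.1 (hfp.symm ▸ hp.one_lt)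
    exact ⟨a, b, hab, (Finset.mem_filter.1 ha).2.trans (Finset.mem_filter.1 hb).2.symm⟩
  choose k' hk' hfk' using fun j => exists_mem_alternatingGroup_comp_eq f hab hfab (k j)
  let s' : alternatingGroup α := ⟨s, hsign⟩
  let h : J → alternatingGroup α := fun j => ⟨k' j, hk' j⟩⁻¹
  have hs1 : s' ≠ 1 := fun hc => by
    have : s = 1 := congrArg Subtype.val hc
    apply (hs.isCycle_pow hp hfp hfq hpq).1.ne_one
    rw [this, one_pow]
  refine exists_isTotalDominatingSet_of_conj hs1 h fun g hg => ?_
  obtain ⟨j, hj⟩ := hk g g.2 (fun hc => hg (Subtype.ext hc))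
  refine ⟨j, ?_⟩
  have hcol : IsCycleColouring (fun x => f (k j x)) ((h j : Perm α) * s * (h j : Perm α)⁻¹) := by
    have hf' : (fun x => f (((h j : Perm α))⁻¹ x)) = fun x => f (k j x) := by
      ext1 x
      rw [← hfk' j x]
      simp [h]
    rw [← hf']
    exact hs.conj (h j : Perm α)
  have hcard : ∀ i, (Finset.univ.filter fun x => f (k j x) = i).card =
      (Finset.univ.filter fun x => f x = i).card := fun i => by
    refine Finset.card_equiv (k j) fun x => ?_
    simp
  exact hcol.alternatingGroup_le_closure hj hp (by rw [hcard, hfp])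
    (fun i => by rw [hcard, hfq]) hpq hpn hn hpn'

/-- An even permutation of an even number of points has a nonempty proper invariant set, since it
is not a full cycle. -/
theorem exists_invariant_of_even [Nontrivial α] (hα : Even (Fintype.card α)) {s : Perm α}
    (hs : s ∈ alternatingGroup α) :
    ∃ D : Set α, (∀ x, s x ∈ D ↔ x ∈ D) ∧ D.Nonempty ∧ D ≠ Set.univ := by
  obtain ⟨a⟩ : Nonempty α := inferInstance
  refine ⟨{x | s.SameCycle a x}, fun x => sameCycle_apply_right, ⟨a, SameCycle.refl _ _⟩, ?_⟩
  intro hD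
  have hall : ∀ x, s.SameCycle a x := fun x => (Set.ext_iff.1 hD x).2 (Set.mem_univ x)
  have hfix : ∀ x, s x ≠ x := fun x hx => by
    obtain ⟨y, hy⟩ := exists_ne x
    have h1 : s.SameCycle x y := (hall x).symm.trans (hall y)
    exact hy (h1.eq_of_left hx).symm
  have hc : s.IsCycle := ⟨a, hfix a, fun x _ => hall x⟩
  have hsupp : s.support = Finset.univ := by
    ext x
    simp [hfix x]
  have := hc.sign
  rw [hsupp, Finset.card_univ, hα.neg_one_pow, mem_alternatingGroup.1 hs] at this
  exact absurd this (by decide)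

/-- Each element of a total dominating set preserves a proper nonempty set of points; a `3`-cycle
supported on points that none of these sets separates generates the group with none of the
elements. -/
theorem IsTotalDominatingSet.card_le_two_pow (hα : Even (Fintype.card α))
    (hα3 : 3 ≤ Fintype.card α) {S : Finset (alternatingGroup α)}
    (hS : IsTotalDominatingSet (S : Set (alternatingGroup α))) :
    Fintype.card α ≤ 2 ^ S.card * 2 := by
  classical
  by_contra! hlt
  have : Nontrivial α := Fintype.one_lt_card_iff_nontrivial.1 (by omega)
  choose D hD hDne hDuniv using fun s : alternatingGroup α => exists_invariant_of_even hα s.2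
  obtain ⟨P, hP⟩ := Fintype.exists_lt_card_fiber_of_mul_lt_card
    (fun (x : α) (s : S) => decide (x ∈ D s)) (n := 2) (by simpa using hlt)
  obtain ⟨a, b, c, ha, hb, hc, hab, hac, hbc⟩ := Finset.two_lt_card_iff.1 hP
  simp only [Finset.mem_filter, Finset.mem_univ, true_and] at ha hb hc
  have h3 := isThreeCycle_swap_mul_swap_same hab hac hbc
  let g : alternatingGroup α := ⟨swap a b * swap a c, h3.mem_alternatingGroup⟩
  obtain ⟨s, hsS, hgs⟩ := hS.2 g (fun h => h3.isCycle.ne_one (congrArg Subtype.val h))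
  -- the subgroup of the alternating group that preserves `D s` contains `g` and `s`
  have hgD : ∀ x, (g : Perm α) x ∈ D s ↔ x ∈ D s := by
    have h1 : (a ∈ D s ↔ b ∈ D s) := by
      simpa using congrFun (ha.trans hb.symm) ⟨s, hsS⟩
    have h2 : (a ∈ D s ↔ c ∈ D s) := by
      simpa using congrFun (ha.trans hc.symm) ⟨s, hsS⟩
    have hsw : ∀ {u v : α}, (u ∈ D s ↔ v ∈ D s) → ∀ x, swap u v x ∈ D s ↔ x ∈ D s := by
      intro u v huv x
      rw [swap_apply_def]
      split_ifs with e1 e2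
      · rw [e1, huv]
      · rw [e2, huv]
      · rfl
    intro x
    change swap a b (swap a c x) ∈ D s ↔ x ∈ D s
    rw [hsw h1, hsw h2]
  have hcl : closure {g, s} ≤ stabilizer (alternatingGroup α) (D s) := by
    have hst : ∀ t : alternatingGroup α, (∀ x, (t : Perm α) x ∈ D s ↔ x ∈ D s) →
        t ∈ stabilizer (alternatingGroup α) (D s) := fun t ht => by
      rw [mem_stabilizer_set]
      exact ht
    rw [closure_le]
    rintro t (rfl | rfl)
    · exact hst _ hgD
    · exact hst _ (hD _)
  have htr := alternatingGroup.isPretransitive_of_three_le_card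
    (α := α) (by rwa [Nat.card_eq_fintype_card])
  apply hDuniv s
  obtain ⟨x, hx⟩ := hDne s
  refine Set.eq_univ_of_forall fun y => ?_
  obtain ⟨t, ht⟩ := exists_smul_eq (alternatingGroup α) x y
  have ht' : t ∈ stabilizer (alternatingGroup α) (D s) :=
    hcl (by rw [show closure {g, s} = ⊤ from hgs]; trivial)
  rw [← ht]
  exact (mem_stabilizer_set.1 ht' x).2 hx

end Domination

/-! ### Even degree at least eight -/

section EvenDegree

open Equiv Equiv.Perm MulAction Subgroup
open scoped Pointwise

/-- For even `n ≥ 8` there is a prime strictly between `n / 4` and `n / 2` not dividing `n`, by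
Bertrand's postulate. -/
theorem exists_prime_of_even {n : ℕ} (hn : 8 ≤ n) (he : Even n) :
    ∃ p, p.Prime ∧ Odd p ∧ ¬ p ∣ n ∧ n < 4 * p ∧ 2 * p < n := by
  obtain ⟨p, hp, hlt, hle⟩ := Nat.exists_prime_lt_and_le_two_mul (n / 4) (by omega)
  have hodd : Odd p := hp.odd_of_ne_two (by omega)
  have h2 : 2 * p < n := by
    obtain ⟨a, rfl⟩ := he
    obtain ⟨b, rfl⟩ := hodd
    omega
  refine ⟨p, hp, hodd, ?_, by omega, h2⟩
  rintro ⟨k, rfl⟩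
  have h3 : 2 < k := by
    by_contra! h
    have := Nat.mul_le_mul_left p h
    omega
  have h4 : k < 4 := by
    by_contra! h
    have := Nat.mul_le_mul_left p h
    omega
  obtain rfl : k = 3 := by omega
  exact Nat.not_even_iff_odd.2 (hodd.mul (by decide)) he

variable {α : Type*} [Fintype α] [DecidableEq α]

/-- If `2 p` is between `n / 2` and `n`, each set or its complement is the intersection or the
union of two `p`-sets, so membership in these two sets determines membership in the given one. -/
theorem exists_pair_separating {p : ℕ} (h2 : 2 * p ≤ Fintype.card α) (h4 : Fintype.card α ≤ 4 * p)
    (B : Finset α) :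
    ∃ D : Bool → Finset α, (∀ b, (D b).card = p) ∧
      ∀ x y, (∀ b, x ∈ D b ↔ y ∈ D b) → (x ∈ B ↔ y ∈ B) := by
  wlog hB : B.card ≤ 2 * p generalizing B
  · obtain ⟨D, hD, hsep⟩ := this Bᶜ (by rw [Finset.card_compl]; omega)
    exact ⟨D, hD, fun x y h => by simpa [not_iff_not] using hsep x y h⟩
  rcases le_total B.card p with hBp | hBp
  · -- `B` is the intersection
    have hc : Bᶜ.card = Fintype.card α - B.card := Finset.card_compl B
    obtain ⟨X, hXB, hX⟩ := Finset.exists_subset_card_eq (s := Bᶜ) (n := p - B.card) (by omega)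
    obtain ⟨Y, hYB, hY⟩ := Finset.exists_subset_card_eq (s := Bᶜ \ X) (n := p - B.card)
      (by rw [Finset.card_sdiff_of_subset hXB]; omega)
    have hXd : Disjoint B X := (Finset.subset_compl_iff_disjoint_left).1 hXB
    have hYd : Disjoint B Y :=
      (Finset.subset_compl_iff_disjoint_left).1 (hYB.trans Finset.sdiff_subset)
    refine ⟨fun b => if b then B ∪ X else B ∪ Y, ?_, fun x y h => ?_⟩
    · rintro (_ | _)
      · simp only [Bool.false_eq_true, if_false]
        rw [Finset.card_union_of_disjoint hYd]; omega
      · simp only [if_true]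
        rw [Finset.card_union_of_disjoint hXd]; omega
    · have ht := h true
      have hf := h false
      simp only [if_true, Bool.false_eq_true, if_false, Finset.mem_union] at ht hf
      have hXY : ∀ z ∈ X, z ∉ Y := fun z hz hzY => (Finset.mem_sdiff.1 (hYB hzY)).2 hz
      have := hXY x
      have := hXY y
      tauto
  · -- `B` is the union
    obtain ⟨X, hXB, hX⟩ := Finset.exists_subset_card_eq hBp
    obtain ⟨Y, hXY, hYB, hY⟩ := Finset.exists_subsuperset_card_eq
      (s := B \ X) (t := B) (n := p) Finset.sdiff_subset
      (by rw [Finset.card_sdiff_of_subset hXB]; omega) hBp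
    refine ⟨fun b => if b then X else Y, ?_, fun x y h => ?_⟩
    · rintro (_ | _)
      · simpa using hY
      · simpa using hX
    · have ht := h true
      have hf := h false
      simp only [if_true, Bool.false_eq_true, if_false] at ht hf
      have hU : ∀ z, z ∈ B ↔ z ∈ X ∨ z ∈ Y := fun z => by
        refine ⟨fun hz => ?_, fun hz => hz.elim (@hXB z) (@hYB z)⟩
        by_cases hzX : z ∈ X
        · exact Or.inl hzX
        · exact Or.inr (hXY (Finset.mem_sdiff.2 ⟨hz, hzX⟩))
      rw [hU, hU, ht, hf]

theorem exists_perm_preimage_eq {P : α → Prop} [DecidablePred P] {D : Finset α}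
    (h : D.card = (Finset.univ.filter P).card) : ∃ k : Perm α, ∀ x, P (k x) ↔ x ∈ D := by
  have hc : Fintype.card {x // x ∈ D} = Fintype.card {x // P x} := by
    rw [Fintype.card_coe, Fintype.card_subtype, h]
  let e : {x // x ∈ D} ≃ {x // P x} := Fintype.equivOfCardEq hc
  refine ⟨e.extendSubtype, fun x => ⟨fun hx => ?_, fun hx => e.extendSubtype_mem x hx⟩⟩
  by_contra hxD
  exact e.extendSubtype_not_mem x hxD hx

/-- A permutation moving a point from one class of a two-colouring to the other connects the
classes. -/
theorem connectsColours_of_option_unit {β : Type*} {f : β → Option Unit} {g : Perm β} {x : β}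
    (h : ¬ (f x = none ↔ f (g x) = none)) : ConnectsColours f g := by
  intro r hr hg y z
  have hne : f x ≠ f (g x) := fun hc => h (by rw [hc])
  have key : ∀ w, r w x := fun w => by
    by_cases hw : f w = f x
    · exact hr _ _ hw
    · refine r.trans (hr w (g x) ?_) (r.symm (hg x))
      revert hw hne
      rcases f w with _ | ⟨⟩ <;> rcases f x with _ | ⟨⟩ <;> rcases f (g x) with _ | ⟨⟩ <;> simp
  exact r.trans (key y) (r.symm (key z))

theorem exists_isTotalDominatingSet_of_even {n : ℕ} (hn : 8 ≤ n) (he : Even n) {L : ℕ}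
    (hL : n ≤ 2 ^ L) :
    ∃ S : Finset (alternatingGroup (Fin n)), (∀ a ∈ S, ∀ b ∈ S, IsConj a b) ∧
      IsTotalDominatingSet (S : Set (alternatingGroup (Fin n))) ∧ S.card ≤ 2 * L := by
  have : Nonempty (Fin n) := ⟨⟨0, by omega⟩⟩
  obtain ⟨p, hp, hodd, hpn, h4, h2⟩ := exists_prime_of_even hn he
  have hq : ¬ p ∣ n - p := fun h => hpn (by
    have := Nat.dvd_add h (dvd_refl p)
    rwa [Nat.sub_add_cancel (by omega)] at this)
  obtain ⟨f, s, hs, hfp, hfq, hsign⟩ := exists_isCycleColouring (α := Fin n) Unit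
    (p := p) (q := n - p) (by simp; omega)
  have hse : s ∈ alternatingGroup (Fin n) := by
    have h5 : Even (p - 1) := by obtain ⟨a, rfl⟩ := hodd; simp
    have h6 : Even (n - p - 1) := by
      obtain ⟨a, rfl⟩ := hodd; obtain ⟨b, rfl⟩ := he; exact ⟨b - a - 1, by omega⟩
    rw [mem_alternatingGroup, hsign, h5.neg_one_pow, h6.neg_one_pow]
    simp
  choose D hDcard hD using fun i : Fin L => exists_pair_separating (α := Fin n) (p := p)
    (by simp; omega) (by simp; omega) (Finset.univ.filter fun x => (x : ℕ).testBit i = true)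
  choose k hk using fun j : Fin L × Bool => exists_perm_preimage_eq (P := fun x => f x = none)
    (D := D j.1 j.2) (by rw [hDcard, hfp])
  have hsep : ∀ g ∈ alternatingGroup (Fin n), g ≠ 1 →
      ∃ j, ConnectsColours (fun x => f (k j x)) g := fun g _ hg1 => by
    by_contra! hc
    apply hg1
    ext x
    simp only [Perm.one_apply]
    congr 1
    apply Fin.ext
    have hbit : ∀ i : Fin L, ((g x : ℕ).testBit i = true ↔ (x : ℕ).testBit i = true) := fun i => by
      have := hD i (g x) x fun b => by
        rw [← hk (i, b), ← hk (i, b)]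
        by_contra hcon
        exact hc (i, b) (connectsColours_of_option_unit (x := x) fun h => hcon h.symm)
      simpa using this
    refine Nat.eq_of_testBit_eq fun i => ?_
    by_cases hi : i < L
    · exact Bool.eq_iff_iff.2 (hbit ⟨i, hi⟩)
    · have hlt : ∀ y : Fin n, (y : ℕ).testBit i = false := fun y =>
        Nat.testBit_eq_false_of_lt (y.2.trans_le (hL.trans
          (Nat.pow_le_pow_right (by norm_num) (not_lt.1 hi))))
      rw [hlt, hlt]
  obtain ⟨S, hS1, hS2, hS3⟩ := hs.exists_isTotalDominatingSet hse hp hfp hfq hq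
    (by simpa using hpn) (by simp; omega) (by simp; omega) k hsep
  exact ⟨S, hS1, hS2, by simpa [mul_comm] using hS3⟩

end EvenDegree

/-! ### Odd degree -/

section OddDegree

open Equiv Equiv.Perm MulAction Subgroup
open scoped Pointwise

/-- For odd `n ≥ 5` there is an odd prime `p` with `n / 6 ≤ p ≤ (n + 1) / 2` not dividing `n`. -/
theorem exists_prime_of_odd {n : ℕ} (hn : 5 ≤ n) (ho : Odd n) :
    ∃ p, p.Prime ∧ Odd p ∧ ¬ p ∣ n ∧ n ≤ 6 * p ∧ 2 * p ≤ n + 1 := by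
  by_cases h17 : n < 17
  · obtain ⟨m, rfl⟩ := ho
    obtain h | h | h | h | h | h : m = 2 ∨ m = 3 ∨ m = 4 ∨ m = 5 ∨ m = 6 ∨ m = 7 := by omega
    · exact ⟨3, by subst h; decide⟩
    · exact ⟨3, by subst h; decide⟩
    · exact ⟨5, by subst h; decide⟩
    · exact ⟨3, by subst h; decide⟩
    · exact ⟨5, by subst h; decide⟩
    · exact ⟨7, by subst h; decide⟩
  obtain ⟨p, hp, hlt, hle⟩ := Nat.exists_prime_lt_and_le_two_mul (n / 4) (by omega)
  have hodd : Odd p := hp.odd_of_ne_two (by omega)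
  have hmod : p % 2 = 1 := Nat.odd_iff.1 hodd
  by_cases hpn : p ∣ n
  · -- then `n = 3 p`, and a prime between `p / 2` and `p` does the job
    obtain ⟨k, rfl⟩ := hpn
    have h2 : 1 < k := by
      by_contra! h
      have := Nat.mul_le_mul_left p h
      omega
    have h4 : k < 4 := by
      by_contra! h
      have := Nat.mul_le_mul_left p h
      omega
    obtain rfl : k = 3 := by
      have : k ≠ 2 := by rintro rfl; exact Nat.not_even_iff_odd.2 ho (even_two.mul_left p)
      omega
    obtain ⟨r, hr, hlt', hle'⟩ := Nat.exists_prime_lt_and_le_two_mul ((p - 1) / 2) (by omega)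
    refine ⟨r, hr, hr.odd_of_ne_two (by omega), fun hd => ?_, by omega, by omega⟩
    rcases (hr.dvd_mul).1 hd with h | h
    · have := (Nat.prime_dvd_prime_iff_eq hr hp).1 h
      omega
    · have := Nat.le_of_dvd (by norm_num) h
      omega
  · exact ⟨p, hp, hodd, hpn, by omega, by omega⟩

variable {α : Type*} [Fintype α] [DecidableEq α]

/-- A nontrivial even permutation has either a cycle of length at least three or two cycles of
length two. -/
theorem exists_embedding_of_mem_alternatingGroup (hα : 4 ≤ Fintype.card α) {g : Perm α}
    (hg : g ∈ alternatingGroup α) (hg1 : g ≠ 1) :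
    ∃ v : Fin 4 ↪ α, g (v 0) = v 1 ∧ (g (v 1) = v 2 ∨ g (v 2) = v 3) := by
  have mk : ∀ x y z w : α, [x, y, z, w].Nodup → g x = y → (g y = z ∨ g z = w) →
      ∃ v : Fin 4 ↪ α, g (v 0) = v 1 ∧ (g (v 1) = v 2 ∨ g (v 2) = v 3) :=
    fun x y z w hnd h1 h2 => ⟨⟨[x, y, z, w].get, List.nodup_iff_injective_get.1 hnd⟩, h1, h2⟩
  by_cases h : ∃ x, g x ≠ x ∧ g (g x) ≠ x
  · obtain ⟨x, h1, h2⟩ := h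
    have hc : ({x, g x, g (g x)} : Finset α).card < Fintype.card α :=
      lt_of_le_of_lt Finset.card_le_three (by omega)
    obtain ⟨w, hw⟩ := Finset.exists_mem_notMem_of_card_lt_card (s := {x, g x, g (g x)})
      (t := Finset.univ) (by rwa [Finset.card_univ])
    refine mk x (g x) (g (g x)) w ?_ rfl (Or.inl rfl)
    have h3 : g (g x) ≠ g x := fun h => h1 (g.injective h)
    simp only [Finset.mem_univ, true_and, Finset.mem_insert, Finset.mem_singleton, not_or] at hw
    simp [h1.symm, h2.symm, h3.symm, Ne.symm hw.1, Ne.symm hw.2.1, Ne.symm hw.2.2]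
  · push Not at h
    obtain ⟨x, hx⟩ : ∃ x, g x ≠ x := by
      by_contra! hc
      exact hg1 (Perm.ext hc)
    obtain ⟨z, hzx, hzy, hz⟩ : ∃ z, z ≠ x ∧ z ≠ g x ∧ g z ≠ z := by
      by_contra! hc
      have hsw : g = swap x (g x) := by
        ext z
        by_cases h1 : z = x
        · rw [h1, swap_apply_left]
        by_cases h2 : z = g x
        · rw [h2, swap_apply_right, h x hx]
        rw [swap_apply_of_ne_of_ne h1 h2, hc z h1 h2]
      have := sign_swap (Ne.symm hx)
      rw [← hsw, mem_alternatingGroup.1 hg] at this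
      exact absurd this (by decide)
    have h4 : g z ≠ x := fun hc => hzy (by rw [← hc, h z hz])
    have h5 : g z ≠ g x := fun hc => hzx (g.injective hc)
    refine mk x (g x) z (g z) ?_ rfl (Or.inr rfl)
    simp [hx.symm, Ne.symm hzx, Ne.symm hzy, h4.symm, h5.symm, hz.symm]

/-- Whether the points `v 0 ↦ v 1` are joined to `v 2` by `v 1 ↦ v 2` or by `v 2 ↦ v 3`, this
pattern of three colours is enough to connect the colour classes. -/
theorem connectsColours_of_option_bool {β : Type*} {f : β → Option Bool} {g : Perm β}
    {v : Fin 4 → β} (hv : g (v 0) = v 1 ∧ (g (v 1) = v 2 ∨ g (v 2) = v 3))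
    (h01 : f (v 0) ≠ f (v 1)) (h02 : f (v 0) ≠ f (v 2)) (h12 : f (v 1) ≠ f (v 2))
    (h32 : f (v 3) ≠ f (v 2)) : ConnectsColours f g := by
  intro r hr hg
  have hcol : ∀ w, f w = f (v 0) ∨ f w = f (v 1) ∨ f w = f (v 2) := fun w => by
    revert h01 h02 h12
    generalize f w = a, f (v 0) = b, f (v 1) = c, f (v 2) = d
    revert a b c d
    decide
  have r01 : r (v 1) (v 0) := r.symm (hv.1 ▸ hg (v 0))
  have r20 : r (v 2) (v 0) := by
    rcases hv.2 with h | h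
    · exact r.trans (r.symm (h ▸ hg (v 1))) r01
    · refine r.trans (h ▸ hg (v 2)) ?_
      rcases hcol (v 3) with h3 | h3 | h3
      · exact hr _ _ h3
      · exact r.trans (hr _ _ h3) r01
      · exact absurd h3 h32
  have key : ∀ w, r w (v 0) := fun w => by
    rcases hcol w with h | h | h
    · exact hr _ _ h
    · exact r.trans (hr _ _ h) r01
    · exact r.trans (hr _ _ h) r20
  exact fun x y => r.trans (key x) (r.symm (key y))

theorem sum_comp_eq_sum_card_mul {β ι : Type*} [Fintype β] [Fintype ι] [DecidableEq ι] (f : β → ι)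
    (H : ι → ℕ) :
    ∑ x, H (f x) = ∑ i, (Finset.univ.filter fun x => f x = i).card * H i := by
  rw [← Finset.sum_fiberwise Finset.univ f]
  refine Finset.sum_congr rfl fun i _ => ?_
  rw [Finset.sum_congr rfl (g := fun _ => H i) (fun x hx => by rw [(Finset.mem_filter.1 hx).2]),
    Finset.sum_const, smul_eq_mul]

/-- At least one in `24` injective quadruples has the connecting colour pattern. -/
theorem card_embedding_le_mul_card_filter {f : α → Option Bool} {p q : ℕ}
    (hfp : (Finset.univ.filter fun x => f x = none).card = p)
    (hfq : ∀ k, (Finset.univ.filter fun x => f x = some k).card = q)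
    (hn : Fintype.card α = p + 2 * q) (hp : 2 ≤ p) (hq : 1 ≤ q)
    (hp6 : Fintype.card α ≤ 6 * p) (hp2 : 2 * p ≤ Fintype.card α + 1) :
    Fintype.card (Fin 4 ↪ α) ≤ 24 * (Finset.univ.filter fun v : Fin 4 ↪ α =>
      f (v 0) ≠ f (v 1) ∧ f (v 0) ≠ f (v 2) ∧ f (v 1) ≠ f (v 2) ∧ f (v 3) ≠ f (v 2)).card := by
  let T : Finset (α × α × α × α) := Finset.univ.filter fun t =>
    (f t.1 ≠ f t.2.1 ∧ f t.1 ≠ f t.2.2.1 ∧ f t.2.1 ≠ f t.2.2.1) ∧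
      (f t.2.2.2 ≠ f t.2.2.1 ∧ t.2.2.2 ≠ t.1 ∧ t.2.2.2 ≠ t.2.1)
  have hT : T.card ≤ (Finset.univ.filter fun v : Fin 4 ↪ α =>
      f (v 0) ≠ f (v 1) ∧ f (v 0) ≠ f (v 2) ∧ f (v 1) ≠ f (v 2) ∧ f (v 3) ≠ f (v 2)).card := by
    have hinj : ∀ t ∈ T, [t.1, t.2.1, t.2.2.1, t.2.2.2].Nodup := fun t ht => by
      obtain ⟨-, ⟨h1, h2, h3⟩, h4, h5, h6⟩ := Finset.mem_filter.1 ht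
      simp [ne_of_apply_ne f h1, ne_of_apply_ne f h2, ne_of_apply_ne f h3,
        (ne_of_apply_ne f h4).symm, h5.symm, h6.symm]
    refine Finset.card_le_card_of_injOn (fun t => if h : t ∈ T then
      ⟨[t.1, t.2.1, t.2.2.1, t.2.2.2].get, List.nodup_iff_injective_get.1 (hinj t h)⟩ else
        Classical.choice (Function.Embedding.nonempty_of_card_le (by simp; omega))) ?_ ?_
    · intro t ht
      have ht' : t ∈ T := ht
      obtain ⟨-, ⟨h1, h2, h3⟩, h4, h5, h6⟩ := Finset.mem_filter.1 ht'
      simp only [ht', dif_pos, Finset.coe_filter, Finset.mem_univ, true_and, Set.mem_ofPred_eq]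
      exact ⟨h1, h2, h3, h4⟩
    · intro t ht u hu htu
      have ht' : t ∈ T := ht
      have hu' : u ∈ T := hu
      simp only [ht', hu', dif_pos] at htu
      have h0 := DFunLike.congr_fun htu 0
      have h1 := DFunLike.congr_fun htu 1
      have h2 := DFunLike.congr_fun htu 2
      have h3 := DFunLike.congr_fun htu 3
      exact Prod.ext h0 (Prod.ext h1 (Prod.ext h2 h3))
  have hd : ∀ i, (Finset.univ.filter fun x => f x = i).card = i.elim p fun _ => q := by
    rintro (_ | k)
    · exact hfp
    · exact hfq k
  -- the number of choices for the last point
  have hlast : ∀ x y z : α, (f x ≠ f y ∧ f x ≠ f z ∧ f y ≠ f z) →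
      (Finset.univ.filter fun w => f w ≠ f z ∧ w ≠ x ∧ w ≠ y).card =
        Fintype.card α - ((f z).elim p fun _ => q) - 2 := fun x y z ⟨h1, h2, h3⟩ => by
    have e1 : (Finset.univ.filter fun w => f w ≠ f z ∧ w ≠ x ∧ w ≠ y) =
        (Finset.univ.filter fun w => f w = f z)ᶜ \ {x, y} := by
      ext w
      simp
    rw [e1, Finset.card_sdiff_of_subset, Finset.card_compl, hd,
      Finset.card_pair (ne_of_apply_ne f h1)]
    intro w hw
    rcases Finset.mem_insert.1 hw with rfl | hw
    · simpa using h2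
    · rw [Finset.mem_singleton.1 hw]
      simpa using h3
  have hTcard : T.card = 4 * p * q ^ 2 * (p + 2 * q - 3) := by
    let H : Option Bool → Option Bool → Option Bool → ℕ := fun i j k =>
      if i ≠ j ∧ i ≠ k ∧ j ≠ k then Fintype.card α - (k.elim p fun _ => q) - 2 else 0
    have e1 : T.card = ∑ x, ∑ y, ∑ z, H (f x) (f y) (f z) := by
      rw [Finset.card_filter]
      simp only [Fintype.sum_prod_type]
      refine Finset.sum_congr rfl fun x _ => Finset.sum_congr rfl fun y _ =>
        Finset.sum_congr rfl fun z _ => ?_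
      by_cases h : f x ≠ f y ∧ f x ≠ f z ∧ f y ≠ f z
      · simp only [h, true_and, H, if_true, ne_eq, not_false_eq_true]
        rw [← Finset.card_filter]
        exact hlast x y z h
      · simp only [h, false_and, H, if_false, Finset.sum_const_zero]
    rw [e1]
    have e2 : ∀ i j, ∑ z, H i j (f z) = ∑ k, (k.elim p fun _ => q) * H i j k := fun i j => by
      rw [sum_comp_eq_sum_card_mul f (H i j)]
      simp only [hd]
    have e3 : ∀ i, ∑ y, ∑ k, (k.elim p fun _ => q) * H i (f y) k =
        ∑ j, (j.elim p fun _ => q) * ∑ k, (k.elim p fun _ => q) * H i j k := fun i => by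
      rw [sum_comp_eq_sum_card_mul f
        (fun j => ∑ k, (k.elim p fun _ => q) * H i j k)]
      simp only [hd]
    simp only [e2, e3]
    rw [sum_comp_eq_sum_card_mul f (fun i => ∑ j, (j.elim p fun _ => q) *
      ∑ k, (k.elim p fun _ => q) * H i j k)]
    simp only [hd, Fintype.sum_option, Fintype.sum_bool, H, hn]
    simp only [Option.elim, ne_eq, reduceCtorEq, not_false_eq_true, not_true_eq_false,
      and_true, and_false, if_true, if_false, Option.some.injEq, Bool.false_eq_true,
      mul_zero, add_zero, zero_add, and_self, Bool.true_eq_false]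
    obtain ⟨a, rfl⟩ := Nat.exists_eq_add_of_le hp
    obtain ⟨b, rfl⟩ := Nat.exists_eq_add_of_le hq
    have s1 : 2 + a + 2 * (1 + b) - (2 + a) - 2 = 2 * b := by omega
    have s2 : 2 + a + 2 * (1 + b) - (1 + b) - 2 = a + b + 1 := by omega
    have s3 : 2 + a + 2 * (1 + b) - 3 = a + 2 * b + 1 := by omega
    rw [s1, s2, s3]
    ring
  have hdesc : Fintype.card (Fin 4 ↪ α) = (p + 2 * q) * (p + 2 * q - 1) * (p + 2 * q - 2) *
      (p + 2 * q - 3) := by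
    rw [Fintype.card_embedding_eq, Fintype.card_fin, hn]
    simp [Nat.descFactorial]
    ring
  calc Fintype.card (Fin 4 ↪ α)
      = (p + 2 * q) * (p + 2 * q - 1) * (p + 2 * q - 2) * (p + 2 * q - 3) := hdesc
    _ ≤ (6 * p) * (4 * q) * (4 * q) * (p + 2 * q - 3) := by
        gcongr <;> omega
    _ = 24 * T.card := by rw [hTcard]; ring
    _ ≤ _ := Nat.mul_le_mul_left 24 hT

/-- The image of an embedding under a uniformly random permutation is uniformly distributed. -/
theorem card_filter_trans_mem_mul_card {m : ℕ} (v : Fin m ↪ α) (W : Finset (Fin m ↪ α)) :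
    (Finset.univ.filter fun k : Perm α => v.trans k.toEmbedding ∈ W).card *
      Fintype.card (Fin m ↪ α) = W.card * Fintype.card (Perm α) := by
  have hN : ∀ w, (Finset.univ.filter fun k : Perm α => v.trans k.toEmbedding = w).card =
      (Finset.univ.filter fun k : Perm α => v.trans k.toEmbedding = v).card := fun w => by
    obtain ⟨π, hπ⟩ := exists_smul_eq_embedding v w
    symm
    refine Finset.card_equiv (Equiv.mulLeft π) fun k => ?_
    have h1 : v.trans (π * k).toEmbedding = π • v.trans k.toEmbedding := rfl
    simp only [Finset.mem_filter, Finset.mem_univ, true_and, Equiv.coe_mulLeft]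
    rw [h1, ← hπ]
    exact (smul_left_cancel_iff π).symm
  have hsum : ∀ X : Finset (Fin m ↪ α),
      (Finset.univ.filter fun k : Perm α => v.trans k.toEmbedding ∈ X).card = X.card *
        (Finset.univ.filter fun k : Perm α => v.trans k.toEmbedding = v).card := fun X => by
    rw [Finset.card_eq_sum_card_fiberwise (t := X) (f := fun k : Perm α => v.trans k.toEmbedding)
      (fun k hk => by simpa using hk), ← smul_eq_mul, ← Finset.sum_const]
    refine Finset.sum_congr rfl fun w hw => ?_
    rw [← hN w, Finset.filter_filter]
    congr 1
    ext k
    simp only [Finset.mem_filter, Finset.mem_univ, true_and]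
    exact ⟨fun h => h.2, fun h => ⟨h ▸ hw, h⟩⟩
  have huniv := hsum Finset.univ
  simp only [Finset.mem_univ, Finset.filter_true, Finset.card_univ] at huniv
  rw [hsum, huniv]
  ring

/-- If at least one in `24` quadruples is good, then `17 K` permutations suffice to move every
quadruple to a good one, where `2 ^ K` exceeds the number of quadruples: by the union bound, since
`(23 / 24) ^ 17 < 1 / 2`. -/
theorem exists_perm_family {W : Finset (Fin 4 ↪ α)}
    (hW : Fintype.card (Fin 4 ↪ α) ≤ 24 * W.card) {K : ℕ}
    (hK : Fintype.card (Fin 4 ↪ α) < 2 ^ K) :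
    ∃ k : Fin (17 * K) → Perm α, ∀ v : Fin 4 ↪ α, ∃ j, v.trans (k j).toEmbedding ∈ W := by
  by_contra! hc
  obtain ⟨v₀, -⟩ := hc 1
  have hE : 0 < Fintype.card (Fin 4 ↪ α) := Fintype.card_pos_iff.2 ⟨v₀⟩
  set E := Fintype.card (Fin 4 ↪ α) with hEdef
  set P := Fintype.card (Perm α) with hPdef
  have hP : 0 < P := Fintype.card_pos
  let bad : (Fin 4 ↪ α) → Finset (Perm α) := fun v =>
    Finset.univ.filter fun k => v.trans k.toEmbedding ∉ W
  have hbad : ∀ v, 24 * (bad v).card ≤ 23 * P := fun v => by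
    have h1 := card_filter_trans_mem_mul_card v W
    have h2 : (Finset.univ.filter fun k : Perm α => v.trans k.toEmbedding ∈ W).card +
        (bad v).card = P := by
      rw [Finset.card_filter_add_card_filter_not, Finset.card_univ]
    set G := (Finset.univ.filter fun k : Perm α => v.trans k.toEmbedding ∈ W).card
    have h3 : E * P ≤ E * (24 * G) := by
      calc E * P ≤ 24 * W.card * P := Nat.mul_le_mul_right P hW
        _ = E * (24 * G) := by rw [mul_assoc, ← h1]; ring
    have h4 := Nat.le_of_mul_le_mul_left h3 hE
    omega
  have hcover : (Finset.univ : Finset (Fin (17 * K) → Perm α)) ⊆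
      Finset.univ.biUnion fun v => Fintype.piFinset fun _ => bad v := fun k _ => by
    obtain ⟨v, hv⟩ := hc k
    simp only [Finset.mem_biUnion, Finset.mem_univ, true_and]
    exact ⟨v, Fintype.mem_piFinset.2 fun j => by simpa [bad] using hv j⟩
  have h1 : P ^ (17 * K) ≤ ∑ v, (bad v).card ^ (17 * K) := by
    have := (Finset.card_le_card hcover).trans Finset.card_biUnion_le
    simpa using this
  have h2 : 24 ^ (17 * K) * P ^ (17 * K) ≤ E * 23 ^ (17 * K) * P ^ (17 * K) := by
    calc 24 ^ (17 * K) * P ^ (17 * K) ≤ 24 ^ (17 * K) * ∑ v, (bad v).card ^ (17 * K) :=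
          Nat.mul_le_mul_left _ h1
      _ = ∑ v, (24 * (bad v).card) ^ (17 * K) := by
          rw [Finset.mul_sum]; simp only [mul_pow]
      _ ≤ ∑ _v : Fin 4 ↪ α, (23 * P) ^ (17 * K) :=
          Finset.sum_le_sum fun v _ => Nat.pow_le_pow_left (hbad v) _
      _ = E * 23 ^ (17 * K) * P ^ (17 * K) := by
          rw [Finset.sum_const, Finset.card_univ, smul_eq_mul, mul_pow, mul_assoc]
  have h3 : 24 ^ (17 * K) ≤ E * 23 ^ (17 * K) :=
    Nat.le_of_mul_le_mul_right h2 (pow_pos hP _)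
  have h4 : 2 ^ K * 23 ^ (17 * K) ≤ 24 ^ (17 * K) := by
    rw [pow_mul, pow_mul, ← mul_pow]
    exact Nat.pow_le_pow_left (by norm_num) K
  have h5 : E * 23 ^ (17 * K) < 2 ^ K * 23 ^ (17 * K) :=
    Nat.mul_lt_mul_of_pos_right hK (by positivity)
  omega

theorem exists_isTotalDominatingSet_of_odd {n : ℕ} (hn : 5 ≤ n) (ho : Odd n) {K : ℕ}
    (hK : n ^ 4 < 2 ^ K) :
    ∃ S : Finset (alternatingGroup (Fin n)), (∀ a ∈ S, ∀ b ∈ S, IsConj a b) ∧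
      IsTotalDominatingSet (S : Set (alternatingGroup (Fin n))) ∧ S.card ≤ 17 * K := by
  have : Nonempty (Fin n) := ⟨⟨0, by omega⟩⟩
  obtain ⟨p, hp, hodd, hpn, h6, h2⟩ := exists_prime_of_odd hn ho
  obtain ⟨q, rfl⟩ : ∃ q, n = p + 2 * q := by
    obtain ⟨a, rfl⟩ := ho
    obtain ⟨b, rfl⟩ := hodd
    exact ⟨a - b, by omega⟩
  have hp2 := hp.two_le
  have hq : ¬ p ∣ q := fun h => hpn (dvd_add (dvd_refl p) (h.mul_left 2))
  obtain ⟨f, s, hs, hfp, hfq, hsign⟩ := exists_isCycleColouring (α := Fin (p + 2 * q)) Bool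
    (p := p) (q := q) (by simp)
  have hse : s ∈ alternatingGroup (Fin (p + 2 * q)) := by
    have h5 : Even (p - 1) := by obtain ⟨a, rfl⟩ := hodd; simp
    rw [mem_alternatingGroup, hsign, h5.neg_one_pow, Fintype.card_bool, ← pow_mul,
      (even_two.mul_left (q - 1)).neg_one_pow, one_mul]
  have hE : Fintype.card (Fin 4 ↪ Fin (p + 2 * q)) < 2 ^ K := by
    refine lt_of_le_of_lt ?_ hK
    rw [Fintype.card_embedding_eq, Fintype.card_fin, Fintype.card_fin]
    exact Nat.descFactorial_le_pow _ _
  obtain ⟨k, hk⟩ := exists_perm_family (card_embedding_le_mul_card_filter hfp hfq (by simp) hp2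
    (by omega) (by simpa using h6) (by simpa using h2)) hE
  have hsep : ∀ g ∈ alternatingGroup (Fin (p + 2 * q)), g ≠ 1 →
      ∃ j, ConnectsColours (fun x => f (k j x)) g := fun g hg hg1 => by
    obtain ⟨v, hv⟩ := exists_embedding_of_mem_alternatingGroup (by simp; omega) hg hg1
    obtain ⟨j, hj⟩ := hk v
    obtain ⟨-, h01, h02, h12, h32⟩ := Finset.mem_filter.1 hj
    exact ⟨j, connectsColours_of_option_bool (v := v) hv h01 h02 h12 h32⟩
  obtain ⟨S, hS1, hS2, hS3⟩ := hs.exists_isTotalDominatingSet hse hp hfp hfq hq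
    (by simpa using hpn) (by simp; omega) (by simpa using h2) k hsep
  exact ⟨S, hS1, hS2, by simpa using hS3⟩

end OddDegree

/-! ### Degree six -/

section DegreeSix

open Equiv Equiv.Perm MulAction Subgroup
open scoped Pointwise

/-- The table of values of a permutation of `Fin 6`. -/
def permTable (g : Perm (Fin 6)) : List ℕ := List.ofFn fun x => (g x : ℕ)

/-- The value at `x` of the map with the given table of values. -/
def tableApply (l : List ℕ) (x : ℕ) : ℕ := l.getD x 0

/-- The value at `x` of the word `g t ^ k₁ g t ^ k₂ ⋯`, for `g` and `t` given by tables. -/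
def wordApply (g t : List ℕ) : List ℕ → ℕ → ℕ
  | [], x => x
  | k :: w, x => tableApply g ((tableApply t)^[k] (wordApply g t w x))

/-- The number of entries of a list that are moved by `φ`. -/
def countMoved (φ : ℕ → ℕ) : List ℕ → ℕ
  | [] => 0
  | x :: l => bif Nat.beq (φ x) x then countMoved φ l else countMoved φ l + 1

/-- Whether the `k`-th power of the permutation with table `l` is trivial. -/
def powIsOne (l : List ℕ) (k : ℕ) : Bool :=
  [0, 1, 2, 3, 4, 5].all fun x => Nat.beq ((tableApply l)^[k] x) x

/-- Five even permutations. Conjugating `(0 1 2 3 4)` by them gives the `5`-cycles of a total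
dominating set of the alternating group of degree six. -/
def sixConj : Fin 5 → Perm (Fin 6) :=
  ![1, swap 0 1 * swap 1 4 * swap 4 5 * swap 2 3, swap 1 2 * swap 2 3 * swap 3 4 * swap 4 5,
    swap 1 5 * swap 5 4 * swap 4 3 * swap 3 2, swap 1 3 * swap 3 5 * swap 5 2 * swap 2 4]

/-- The `5`-cycle `(0 1 2 3 4)`. -/
def fiveCycle : Perm (Fin 6) := swap 0 1 * swap 1 2 * swap 2 3 * swap 3 4

/-- The tables and the fixed points of the conjugates of the `5`-cycle by `sixConj`. -/
def fiveCycleTables : List (Fin 5 × List ℕ × ℕ) :=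
  [(0, [1, 2, 3, 4, 0, 5], 5), (1, [0, 4, 5, 2, 3, 1], 0), (2, [2, 1, 3, 4, 5, 0], 1),
    (3, [5, 2, 3, 0, 4, 1], 4), (4, [3, 0, 2, 4, 5, 1], 2)]

/-- The exponents `k₁, k₂, …` of some words `g t ^ k₁ g t ^ k₂ ⋯`. -/
def wordList : List (List ℕ) :=
  [[0, 0, 3, 2], [1, 1, 3, 4], [2, 2], [1, 2, 4], [0, 4, 4, 3], [0, 3, 3, 1], [2, 4, 3]]

/-- Whether the permutation with table `g` moves the fixed point of one of the `5`-cycles `t` such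
that a word in `g` and `t` is a `3`-cycle. -/
def yieldsThreeCycle (g : List ℕ) : Bool :=
  fiveCycleTables.any fun t => !(Nat.beq (tableApply g t.2.2) t.2.2) &&
    wordList.any fun w => Nat.beq (countMoved (wordApply g t.2.1 w) [0, 1, 2, 3, 4, 5]) 3

set_option maxRecDepth 100000 in
/-- Each permutation of prime order of six points passes the test `yieldsThreeCycle`. -/
theorem all_permutations_yieldsThreeCycle :
    ([0, 1, 2, 3, 4, 5].permutations'.all fun l => powIsOne l 1 ||
      (!(powIsOne l 2) && !(powIsOne l 3) && !(powIsOne l 5)) || yieldsThreeCycle l) = true := by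
  decide +kernel

theorem tableApply_permTable (g : Perm (Fin 6)) (x : Fin 6) :
    tableApply (permTable g) x = g x := by
  rw [tableApply, permTable, List.getD_eq_getElem _ _ (by simp), List.getElem_ofFn]

theorem iterate_tableApply_permTable (g : Perm (Fin 6)) (k : ℕ) (x : Fin 6) :
    (tableApply (permTable g))^[k] x = (g ^ k) x := by
  induction k with
  | zero => rfl
  | succ k ih =>
    rw [Function.iterate_succ_apply', ih, tableApply_permTable, pow_succ', Perm.mul_apply]

theorem wordApply_permTable (g t : Perm (Fin 6)) (w : List ℕ) (x : Fin 6) :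
    wordApply (permTable g) (permTable t) w x = (w.map fun k => g * t ^ k).prod x := by
  induction w with
  | nil => rfl
  | cons k w ih =>
    rw [wordApply, ih, iterate_tableApply_permTable, tableApply_permTable, List.map_cons,
      List.prod_cons, Perm.mul_apply, Perm.mul_apply]

theorem countMoved_eq_card_support {φ : ℕ → ℕ} {g : Perm (Fin 6)}
    (h : ∀ x : Fin 6, φ x = g x) : countMoved φ [0, 1, 2, 3, 4, 5] = g.support.card := by
  have h1 : g.support = Finset.univ.filter fun x => g x ≠ x := by
    ext x
    simp
  have key : ∀ (x : Fin 6) (l : List ℕ), countMoved φ ((x : ℕ) :: l) =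
      (if g x ≠ x then 1 else 0) + countMoved φ l := fun x l => by
    rw [countMoved, h x]
    by_cases hx : g x = x
    · simp [hx]
    · have : Nat.beq (g x) x = false := by
        rw [Bool.eq_false_iff]
        exact fun hc => hx (Fin.ext (Nat.eq_of_beq_eq_true hc))
      simp [hx, this, add_comm]
  rw [h1, Finset.card_filter, Fin.sum_univ_six]
  rw [show [0, 1, 2, 3, 4, 5] = [((0 : Fin 6) : ℕ), ((1 : Fin 6) : ℕ), ((2 : Fin 6) : ℕ),
    ((3 : Fin 6) : ℕ), ((4 : Fin 6) : ℕ), ((5 : Fin 6) : ℕ)] from rfl]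
  rw [key, key, key, key, key, key, countMoved]
  ring

theorem powIsOne_permTable (g : Perm (Fin 6)) (k : ℕ) :
    powIsOne (permTable g) k = true ↔ g ^ k = 1 := by
  have h1 : ∀ x : Fin 6, Nat.beq ((tableApply (permTable g))^[k] x) x = true ↔ (g ^ k) x = x :=
    fun x => by rw [iterate_tableApply_permTable, Nat.beq_eq, Fin.val_inj]
  rw [powIsOne, List.all_eq_true]
  constructor
  · intro h
    ext1 x
    refine (h1 x).1 (h x ?_)
    fin_cases x <;> simp
  · intro h x hx
    have hx6 : x < 6 := by
      simp only [List.mem_cons, List.not_mem_nil, or_false] at hx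
      omega
    exact (h1 ⟨x, hx6⟩).2 (by rw [h]; rfl)

theorem isCycleColouring_fiveCycle :
    IsCycleColouring (fun x : Fin 6 => if x = 5 then some () else none) fiveCycle := by
  have h1 : ∀ x, (fiveCycle x = 5 ↔ x = 5) := by decide
  have h2 : ∀ x y : Fin 6, (x = 5 ↔ y = 5) → ∃ i : Fin 5, (fiveCycle ^ (i : ℕ)) x = y := by
    decide +kernel
  intro x y
  have h3 : ((if x = 5 then some () else none) = if y = 5 then some () else none) ↔
      (x = 5 ↔ y = 5) := by
    by_cases hx : x = 5 <;> by_cases hy : y = 5 <;> simp [hx, hy]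
  rw [h3]
  constructor
  · intro h
    obtain ⟨i, rfl⟩ := h.exists_nat_pow_eq
    clear h h3
    induction i with
    | zero => simp
    | succ i ih => rwa [pow_succ', Perm.mul_apply, h1]
  · intro h
    obtain ⟨i, hi⟩ := h2 x y h
    exact ⟨(i : ℕ), by rw [zpow_natCast, hi]⟩

theorem fiveCycleTables_spec : ∀ t ∈ fiveCycleTables,
    permTable (sixConj t.1 * fiveCycle * (sixConj t.1)⁻¹) = t.2.1 ∧
      (sixConj t.1 5 : ℕ) = t.2.2 := by
  decide +kernel

/-- Every `g ≠ 1` generates at least the alternating group together with one of the five `5`-cycles.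
Passing to a power, `g` may be taken of prime order; then the two generate a primitive group in
which some word is a `3`-cycle. -/
theorem exists_alternatingGroup_le_closure_six {g : Perm (Fin 6)} (hg : g ≠ 1) :
    ∃ j, alternatingGroup (Fin 6) ≤
      closure {g, sixConj j * fiveCycle * (sixConj j)⁻¹} := by
  wlog hprime : (orderOf g).Prime generalizing g
  · have ho : orderOf g ≠ 1 := by rwa [Ne, orderOf_eq_one_iff]
    have hm := Nat.minFac_prime ho
    have horder : orderOf (g ^ (orderOf g / (orderOf g).minFac)) = (orderOf g).minFac :=
      orderOf_pow_orderOf_div (orderOf_pos g).ne' (Nat.minFac_dvd _)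
    obtain ⟨j, hj⟩ := this (g := g ^ (orderOf g / (orderOf g).minFac))
      (fun hc => hm.one_lt.ne' (by rw [← horder, hc, orderOf_one])) (by rwa [horder])
    refine ⟨j, hj.trans ?_⟩
    rw [closure_le]
    rintro x (rfl | rfl)
    · exact pow_mem (subset_closure (by simp)) _
    · exact subset_closure (by simp)
  have hpow : g ^ 2 = 1 ∨ g ^ 3 = 1 ∨ g ^ 5 = 1 := by
    have hdvd : orderOf g ∣ Nat.factorial 6 := by
      have := orderOf_dvd_card (x := g)
      rwa [Fintype.card_perm, Fintype.card_fin] at this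
    have hle := (hprime.dvd_factorial).1 hdvd
    have hone := pow_orderOf_eq_one g
    generalize orderOf g = m at *
    interval_cases m
    · exact absurd hprime (by decide)
    · exact absurd hprime (by decide)
    · exact Or.inl hone
    · exact Or.inr (Or.inl hone)
    · exact absurd hprime (by decide)
    · exact Or.inr (Or.inr hone)
    · exact absurd hprime (by decide)
  have hmem : permTable g ∈ [0, 1, 2, 3, 4, 5].permutations' := by
    rw [List.mem_permutations']
    exact Equiv.Perm.ofFn_comp_perm g fun x : Fin 6 => (x : ℕ)
  have hall := List.all_eq_true.1 all_permutations_yieldsThreeCycle _ hmem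
  have hone : powIsOne (permTable g) 1 = false := by
    rw [Bool.eq_false_iff, Ne, powIsOne_permTable, pow_one]
    exact hg
  have hyields : yieldsThreeCycle (permTable g) = true := by
    simp only [← powIsOne_permTable] at hpow
    rw [hone] at hall
    rcases hpow with h | h | h <;> simpa [h] using hall
  obtain ⟨⟨j, l, c⟩, ht, hjc⟩ := List.any_eq_true.1 hyields
  obtain ⟨htab, hfix⟩ := fiveCycleTables_spec _ ht
  simp only [Bool.and_eq_true, Bool.not_eq_true', List.any_eq_true] at htab hfix hjc
  obtain ⟨hmove, w, -, hw⟩ := hjc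
  refine ⟨j, ?_⟩
  set t := sixConj j * fiveCycle * (sixConj j)⁻¹ with htdef
  have hcol := isCycleColouring_fiveCycle.conj (sixConj j)
  rw [← htdef] at hcol
  have hconn : ConnectsColours
      (fun x => if (sixConj j)⁻¹ x = 5 then some () else none) g := by
    have hne : g (sixConj j 5) ≠ sixConj j 5 := fun hc => by
      rw [← hfix, tableApply_permTable, hc, ← Bool.not_eq_true, Nat.beq_eq] at hmove
      exact hmove rfl
    refine connectsColours_of_option_unit (x := sixConj j 5) ?_
    have h1 : (sixConj j)⁻¹ (sixConj j 5) = 5 := (sixConj j).symm_apply_apply 5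
    have h2 : (sixConj j)⁻¹ (g (sixConj j 5)) ≠ 5 := fun hc => hne (by
      rwa [Perm.inv_eq_iff_eq] at hc)
    rw [h1, if_pos rfl, if_neg h2]
    simp
  have hcard : ∀ k, (Finset.univ.filter fun x : Fin 6 =>
      (if (sixConj j)⁻¹ x = 5 then some () else none) = k).card =
        (Finset.univ.filter fun x : Fin 6 => (if x = 5 then some () else none) = k).card :=
    fun k => Finset.card_equiv (sixConj j)⁻¹ fun x => by simp
  have hprim := hcol.isPreprimitive_closure hconn Nat.prime_five (q := 1)
    (by rw [hcard]; decide) (fun k => by rw [hcard]; revert k; decide) (by decide) (by decide)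
    (by decide)
  refine alternatingGroup_le_of_isPreprimitive_of_isThreeCycle_mem hprim
    (g := (w.map fun k => g * t ^ k).prod) ?_ ?_
  · rw [← card_support_eq_three_iff, ← countMoved_eq_card_support (wordApply_permTable g t w), htab]
    exact Nat.eq_of_beq_eq_true hw
  · refine list_prod_mem fun x hx => ?_
    obtain ⟨k, -, rfl⟩ := List.mem_map.1 hx
    exact mul_mem (subset_closure (by simp)) (pow_mem (subset_closure (by simp)) k)

theorem exists_isTotalDominatingSet_six :
    ∃ S : Finset (alternatingGroup (Fin 6)), (∀ a ∈ S, ∀ b ∈ S, IsConj a b) ∧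
      IsTotalDominatingSet (S : Set (alternatingGroup (Fin 6))) ∧ S.card ≤ 5 := by
  have h1 : ∀ j, sixConj j ∈ alternatingGroup (Fin 6) := by
    simp only [mem_alternatingGroup]
    decide +kernel
  have h2 : fiveCycle ∈ alternatingGroup (Fin 6) := by
    rw [mem_alternatingGroup]
    decide +kernel
  have hne : fiveCycle ≠ 1 := by decide
  refine exists_isTotalDominatingSet_of_conj (s := ⟨fiveCycle, h2⟩)
    (fun hc => hne (congrArg Subtype.val hc))
    (fun j : Fin 5 => ⟨sixConj j, h1 j⟩) fun g hg => ?_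
  exact exists_alternatingGroup_le_closure_six fun hc => hg (Subtype.ext hc)

end DegreeSix

/-! ### The uniform domination number -/

section UniformDomination

open Equiv Equiv.Perm MulAction Subgroup
open scoped Pointwise

/-- A total dominating set of pairwise conjugate elements witnesses uniform spread `1`. -/
theorem IsTotalDominatingSet.hasUniformSpread_one {G : Type*} [Group G] [Nontrivial G]
    {S : Set G} (hS : IsTotalDominatingSet S) (hconj : ∀ a ∈ S, ∀ b ∈ S, IsConj a b) :
    HasUniformSpread G 1 := by
  obtain ⟨g, hg⟩ := exists_ne (1 : G)
  obtain ⟨s, hs, -⟩ := hS.2 g hg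
  refine ⟨ConjClasses.mk s, fun x hx => ?_⟩
  obtain ⟨t, ht, hxt⟩ := hS.2 (x 0) (hx 0)
  refine ⟨t, ConjClasses.mem_carrier_iff_mk_eq.2
    (ConjClasses.mk_eq_mk_iff_isConj.2 (hconj t ht s hs)), fun i => ?_⟩
  rwa [Subsingleton.elim i 0]

theorem exists_isTotalDominatingSet_card_le_clog {n : ℕ} (hn : 6 ≤ n) (he : Even n) :
    ∃ S : Finset (alternatingGroup (Fin n)), (∀ a ∈ S, ∀ b ∈ S, IsConj a b) ∧
      IsTotalDominatingSet (S : Set (alternatingGroup (Fin n))) ∧ S.card ≤ 2 * Nat.clog 2 n := by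
  rcases hn.eq_or_lt with rfl | hn
  · obtain ⟨S, h1, h2, h3⟩ := exists_isTotalDominatingSet_six
    have : 2 < Nat.clog 2 6 := (Nat.lt_clog_iff_pow_lt (by norm_num)).2 (by norm_num)
    exact ⟨S, h1, h2, by omega⟩
  · obtain ⟨a, rfl⟩ := he
    exact exists_isTotalDominatingSet_of_even (by omega) ⟨a, rfl⟩
      (Nat.le_pow_clog (by norm_num) _)

theorem two_le_logb_two {n : ℕ} (hn : 4 ≤ n) : 2 ≤ Real.logb 2 (n : ℝ) := by
  rw [Real.le_logb_iff_rpow_le (by norm_num) (by positivity)]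
  norm_num
  exact_mod_cast hn

theorem ceil_logb_two (n : ℕ) : ⌈Real.logb 2 (n : ℝ)⌉ = (Nat.clog 2 n : ℤ) := by
  have := Real.ceil_logb_natCast (b := 2) (r := (n : ℝ)) (Nat.cast_nonneg n)
  rw [Int.clog_natCast] at this
  exact_mod_cast this

theorem exists_isTotalDominatingSet_card_le_logb {n : ℕ} (hn : 5 ≤ n) :
    ∃ S : Finset (alternatingGroup (Fin n)), (∀ a ∈ S, ∀ b ∈ S, IsConj a b) ∧
      IsTotalDominatingSet (S : Set (alternatingGroup (Fin n))) ∧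
        (S.card : ℝ) ≤ 77 * Real.logb 2 (n : ℝ) := by
  have hlog := two_le_logb_two (n := n) (by omega)
  rcases Nat.even_or_odd n with he | ho
  · obtain ⟨S, h1, h2, h3⟩ := exists_isTotalDominatingSet_card_le_clog
      (by obtain ⟨a, rfl⟩ := he; omega) he
    refine ⟨S, h1, h2, ?_⟩
    have h4 : (Nat.clog 2 n : ℝ) < Real.logb 2 n + 1 := by
      have := Int.ceil_lt_add_one (Real.logb 2 (n : ℝ))
      rwa [ceil_logb_two, Int.cast_natCast] at this
    have h5 : (S.card : ℝ) ≤ 2 * (Nat.clog 2 n : ℝ) := by exact_mod_cast h3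
    linarith
  · obtain ⟨S, h1, h2, h3⟩ := exists_isTotalDominatingSet_of_odd hn ho
      (Nat.lt_pow_succ_log_self (b := 2) (by norm_num) (n ^ 4))
    refine ⟨S, h1, h2, ?_⟩
    have h4 : (Nat.log 2 (n ^ 4) : ℝ) ≤ 4 * Real.logb 2 n := by
      have := Real.natLog_le_logb (n ^ 4) 2
      rw [Nat.cast_pow, Real.logb_pow] at this
      exact_mod_cast this
    have h5 : (S.card : ℝ) ≤ 17 * (Nat.log 2 (n ^ 4) + 1) := by exact_mod_cast h3
    linarith

end UniformDomination

theorem theorem2 :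
    (∀ n : ℕ, 5 ≤ n →
      HasUniformSpread (alternatingGroup (Fin n)) 1 ∧
      (uniformDominationNumber (alternatingGroup (Fin n)) : ℝ) ≤ 77 * Real.logb 2 (n : ℝ)) ∧
    (∀ n : ℕ, 6 ≤ n → Even n →
      ⌈Real.logb 2 (n : ℝ)⌉ - 1 ≤ (uniformDominationNumber (alternatingGroup (Fin n)) : ℤ) ∧
      (uniformDominationNumber (alternatingGroup (Fin n)) : ℤ) ≤ 2 * ⌈Real.logb 2 (n : ℝ)⌉) := by
  refine ⟨fun n hn => ?_, fun n hn he => ?_⟩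
  · obtain ⟨S, h1, h2, h3⟩ := exists_isTotalDominatingSet_card_le_logb hn
    have : Nontrivial (alternatingGroup (Fin n)) :=
      alternatingGroup.nontrivial_of_three_le_card (by simp; omega)
    refine ⟨h2.hasUniformSpread_one h1, le_trans ?_ h3⟩
    have : uniformDominationNumber (alternatingGroup (Fin n)) ≤ S.card :=
      Nat.sInf_le ⟨S, h1, h2, rfl⟩
    exact_mod_cast this
  · obtain ⟨S, h1, h2, h3⟩ := exists_isTotalDominatingSet_card_le_clog hn he
    rw [ceil_logb_two]
    constructor
    · -- the infimum is attained, as the set of sizes is nonempty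
      obtain ⟨T, -, hT, hcard⟩ := Nat.sInf_mem
        (s := {m : ℕ | ∃ S : Finset (alternatingGroup (Fin n)), (∀ a ∈ S, ∀ b ∈ S, IsConj a b) ∧
          IsTotalDominatingSet (S : Set (alternatingGroup (Fin n))) ∧ S.card = m})
        ⟨S.card, S, h1, h2, rfl⟩
      have hle := hT.card_le_two_pow (by simpa using he) (by simp; omega)
      rw [Fintype.card_fin, ← pow_succ] at hle
      have hclog : Nat.clog 2 n ≤ T.card + 1 := (Nat.clog_le_iff_le_pow (by norm_num)).2 hle
      have : uniformDominationNumber (alternatingGroup (Fin n)) = T.card := hcard.symm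
      rw [this]
      omega
    · have : uniformDominationNumber (alternatingGroup (Fin n)) ≤ S.card :=
        Nat.sInf_le ⟨S, h1, h2, rfl⟩
      omega
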